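/- Let $q,s\in\mathbb{C}^\times$ with $s^2=q$ (write $s=q^{1/2}$) and let $\kappa_1,\dots,\kappa_6\in\mathbb{C}^\times$. Let $\mathcal{W}$ be the ultralocal Weyl algebra on six Weyl pairs, i.e. the complex algebra generated by invertible elements $u_1,w_1,\dots,u_6,w_6$ with $$u_iw_j=q^{\delta_{ij}}w_ju_i,\qquad u_iu_j=u_ju_i,\qquad w_iw_j=w_jw_i ,$$ and let $\mathcal{D}$ be its skew field of fractions (the rational functions of the six Weyl pairs). For pairwise distinct $i,j,k\in\{1,\dots,6\}$ put $$\Lambda_1=u_i^{-1}u_k-q^{1/2}u_i^{-1}w_i+\kappa_i\,w_iu_j^{-1},$$ $$\Lambda_2=\frac{\kappa_i}{\kappa_j}u_j^{-1}w_k^{-1}+\frac{\kappa_k}{\kappa_j}u_i^{-1}w_j^{-1}-\frac{\kappa_i\kappa_k}{q^{1/2}\kappa_j}u_j^{-1}w_j^{-1},$$ $$\Lambda_3=w_iw_k^{-1}-q^{1/2}u_kw_k^{-1}+\kappa_k\,w_j^{-1}u_k .$$ Then there is exactly one $\mathbb{C}$-algebra automorphism $\mathcal{R}_{ijk}$ of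 $\mathcal{D}$ with $$w_i\mapsto w_j\Lambda_3,\quad w_j\mapsto\Lambda_3^{-1}w_i,\quad w_k\mapsto\Lambda_2^{-1}u_i^{-1},\quad u_i\mapsto\Lambda_2^{-1}w_k^{-1},\quad u_j\mapsto\Lambda_1^{-1}u_k,\quad u_k\mapsto u_j\Lambda_1$$ and $u_l\mapsto u_l$, $w_l\mapsto w_l$ for $l\notin\{i,j,k\}$. These automorphisms satisfy the tetrahedron equation $$\mathcal{R}_{123}\cdot\mathcal{R}_{145}\cdot\mathcal{R}_{246}\cdot\mathcal{R}_{356}=\mathcal{R}_{356}\cdot\mathcal{R}_{246}\cdot\mathcal{R}_{145}\cdot\mathcal{R}_{123},$$ where $(\mathcal{A}\cdot\mathcal{B})(\Phi)=\mathcal{A}(\mathcal{B}(\Phi))$ for $\Phi\in\mathcal{D}$. -/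

import Mathlib

/-!
The ultralocal Weyl algebra of `n` Weyl pairs `u i, w i`, with
`u i * w j = q ^ (if i = j then 1 else 0) * w j * u i`, its skew field of rational functions,
and the mapping `R i j k`.
-/

/-- Exponents `(a, b)` of the ordered monomials `u ^ a * w ^ b`. -/
abbrev WeylExp (n : ℕ) : Type := (Fin n → ℤ) × (Fin n → ℤ)

/-- The ultralocal Weyl algebra on `n` pairs of invertible generators (the tensor product of `n`
copies of the algebra of one Weyl pair), as the complex vector space with basis the monomials
`u ^ a * w ^ b = (∏ i, u i ^ a i) * (∏ i, w i ^ b i)`. -/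
def WeylAlg (_q : ℂˣ) (n : ℕ) : Type := WeylExp n →₀ ℂ

namespace WeylAlg

variable {q : ℂˣ} {n : ℕ}

noncomputable instance : AddCommGroup (WeylAlg q n) :=
  inferInstanceAs (AddCommGroup (WeylExp n →₀ ℂ))

noncomputable instance : Module ℂ (WeylAlg q n) :=
  inferInstanceAs (Module ℂ (WeylExp n →₀ ℂ))

/-- The family of coefficients with respect to the basis of monomials. -/
noncomputable def coeff : WeylAlg q n ≃ₗ[ℂ] (WeylExp n →₀ ℂ) :=
  LinearEquiv.refl ℂ (WeylExp n →₀ ℂ)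

/-- The scalar multiple `x * u ^ a * w ^ b` of a monomial, `e = (a, b)`. -/
noncomputable def mono (q : ℂˣ) {n : ℕ} (e : WeylExp n) (x : ℂ) : WeylAlg q n :=
  coeff.symm (Finsupp.single e x)

/-- The number `c` in `(u ^ a * w ^ b) * (u ^ a' * w ^ b') = c * u ^ (a + a') * w ^ (b + b')`. -/
noncomputable def twist (q : ℂˣ) {n : ℕ} (e f : WeylExp n) : ℂ :=
  ((q ^ (-(∑ i, e.2 i * f.1 i)) : ℂˣ) : ℂ)

noncomputable instance : Mul (WeylAlg q n) :=
  ⟨fun x y => (coeff x).sum fun e a => (coeff y).sum fun f b =>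
    mono q (e + f) (a * b * twist q e f)⟩

noncomputable instance : One (WeylAlg q n) := ⟨mono q 0 1⟩

theorem mul_def (x y : WeylAlg q n) :
    x * y = (coeff x).sum fun e a => (coeff y).sum fun f b =>
      mono q (e + f) (a * b * twist q e f) := rfl

theorem coeff_mono (e : WeylExp n) (x : ℂ) : coeff (mono q e x) = Finsupp.single e x :=
  coeff.apply_symm_apply _

theorem mono_zero (e : WeylExp n) : mono q e 0 = 0 := by simp [mono]

theorem mono_add (e : WeylExp n) (x y : ℂ) : mono q e (x + y) = mono q e x + mono q e y := by
  simp [mono]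

theorem smul_mono (c : ℂ) (e : WeylExp n) (x : ℂ) : c • mono q e x = mono q e (c * x) := by
  simp [mono, ← map_smul]

theorem twist_ne_zero (e f : WeylExp n) : twist q e f ≠ 0 := Units.ne_zero _

theorem twist_add_left (e f g : WeylExp n) : twist q (e + f) g = twist q e g * twist q f g := by
  simp only [twist, ← Units.val_mul, ← zpow_add]
  congr 2
  simp only [Prod.snd_add, Pi.add_apply, add_mul, Finset.sum_add_distrib]
  ring

theorem twist_add_right (e f g : WeylExp n) : twist q e (f + g) = twist q e f * twist q e g := by
  simp only [twist, ← Units.val_mul, ← zpow_add]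
  congr 2
  simp only [Prod.fst_add, Pi.add_apply, mul_add, Finset.sum_add_distrib]
  ring

theorem twist_zero_left (f : WeylExp n) : twist q 0 f = 1 := by simp [twist]

theorem twist_zero_right (e : WeylExp n) : twist q e 0 = 1 := by simp [twist]

theorem mono_mul_mono (e f : WeylExp n) (x y : ℂ) :
    mono q e x * mono q f y = mono q (e + f) (x * y * twist q e f) := by
  rw [mul_def, coeff_mono, coeff_mono, Finsupp.sum_single_index, Finsupp.sum_single_index] <;>
    simp [mono_zero]

theorem induction_on {P : WeylAlg q n → Prop} (x : WeylAlg q n) (h0 : P 0)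
    (hadd : ∀ x y, P x → P y → P (x + y)) (hm : ∀ e a, P (mono q e a)) : P x := by
  rw [← coeff.symm_apply_apply x]
  induction coeff x using Finsupp.induction_linear with
  | zero => simpa using h0
  | add f g hf hg => simpa using hadd _ _ hf hg
  | single e a => exact hm e a

theorem right_distrib' (x y z : WeylAlg q n) : (x + y) * z = x * z + y * z := by
  simp only [mul_def, map_add]
  refine Finsupp.sum_add_index' (fun e => ?_) (fun e a b => ?_)
  · simp [mono_zero, Finsupp.sum]
  · rw [← Finsupp.sum_add]
    simp [add_mul, mono_add]

theorem left_distrib' (x y z : WeylAlg q n) : x * (y + z) = x * y + x * z := by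
  simp only [mul_def, map_add]
  rw [← Finsupp.sum_add]
  refine Finsupp.sum_congr fun e _ => ?_
  refine Finsupp.sum_add_index' (fun f => ?_) (fun f a b => ?_)
  · simp [mono_zero]
  · simp [mul_add, add_mul, mono_add]

theorem zero_mul' (x : WeylAlg q n) : 0 * x = 0 := by simp [mul_def]

theorem mul_zero' (x : WeylAlg q n) : x * 0 = 0 := by simp [mul_def]

theorem mul_assoc' (x y z : WeylAlg q n) : x * y * z = x * (y * z) := by
  induction x using induction_on with
  | h0 => simp only [zero_mul']
  | hadd x₁ x₂ h₁ h₂ => simp only [right_distrib', h₁, h₂]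
  | hm e a =>
    induction y using induction_on with
    | h0 => simp only [zero_mul', mul_zero']
    | hadd y₁ y₂ h₁ h₂ => simp only [right_distrib', left_distrib', h₁, h₂]
    | hm f b =>
      induction z using induction_on with
      | h0 => simp only [mul_zero']
      | hadd z₁ z₂ h₁ h₂ => simp only [left_distrib', h₁, h₂]
      | hm g c =>
        simp only [mono_mul_mono, add_assoc, twist_add_left, twist_add_right]
        congr 1
        ring

theorem one_def : (1 : WeylAlg q n) = mono q 0 1 := rfl

noncomputable instance : Ring (WeylAlg q n) where
  __ := (inferInstance : AddCommGroup (WeylAlg q n))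
  left_distrib := left_distrib'
  right_distrib := right_distrib'
  zero_mul := zero_mul'
  mul_zero := mul_zero'
  mul_assoc := mul_assoc'
  one_mul x := by
    induction x using induction_on with
    | h0 => exact mul_zero' 1
    | hadd x y hx hy => rw [left_distrib', hx, hy]
    | hm e a => simp [one_def, mono_mul_mono, twist_zero_left]
  mul_one x := by
    induction x using induction_on with
    | h0 => exact zero_mul' 1
    | hadd x y hx hy => rw [right_distrib', hx, hy]
    | hm e a => simp [one_def, mono_mul_mono, twist_zero_right]

noncomputable instance : Algebra ℂ (WeylAlg q n) :=
  Algebra.ofModule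
    (fun c x y => by
      induction x using induction_on with
      | h0 => simp
      | hadd x₁ x₂ h₁ h₂ => simp only [smul_add, add_mul, h₁, h₂]
      | hm e a =>
        induction y using induction_on with
        | h0 => simp
        | hadd y₁ y₂ h₁ h₂ => simp only [smul_add, mul_add, h₁, h₂]
        | hm f b => simp only [mono_mul_mono, smul_mono, mul_assoc])
    (fun c x y => by
      induction x using induction_on with
      | h0 => simp
      | hadd x₁ x₂ h₁ h₂ => simp only [smul_add, add_mul, h₁, h₂]
      | hm e a =>
        induction y using induction_on with
        | h0 => simp
        | hadd y₁ y₂ h₁ h₂ => simp only [smul_add, mul_add, h₁, h₂]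
        | hm f b =>
          simp only [mono_mul_mono, smul_mono]
          congr 1
          ring)

/-- The generator `u i`. -/
noncomputable def u (q : ℂˣ) {n : ℕ} (i : Fin n) : WeylAlg q n := mono q (Pi.single i 1, 0) 1

/-- The generator `w i`. -/
noncomputable def w (q : ℂˣ) {n : ℕ} (i : Fin n) : WeylAlg q n := mono q (0, Pi.single i 1) 1

theorem u_mul_w (i j : Fin n) :
    u q i * w q j = ((q : ℂ) ^ (if i = j then 1 else 0)) • (w q j * u q i) := by
  by_cases h : i = j
  · subst h
    simp [u, w, mono_mul_mono, smul_mono, twist, Pi.single_apply]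
  · simp [u, w, mono_mul_mono, twist, Pi.single_apply, h]

theorem u_mul_u (i j : Fin n) : u q i * u q j = u q j * u q i := by
  simp [u, mono_mul_mono, twist, add_comm]

theorem w_mul_w (i j : Fin n) : w q i * w q j = w q j * w q i := by
  simp [w, mono_mul_mono, twist, add_comm]

/-! The Weyl algebra is a domain and satisfies the Ore condition. -/

instance : Nontrivial (WeylAlg q n) :=
  inferInstanceAs (Nontrivial (WeylExp n →₀ ℂ))

theorem coeff_mul_of_unique (x y : WeylAlg q n) (e₀ f₀ : WeylExp n)
    (h : UniqueAdd (coeff x).support (coeff y).support e₀ f₀) :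
    coeff (x * y) (e₀ + f₀) = coeff x e₀ * coeff y f₀ * twist q e₀ f₀ := by
  classical
  simp only [mul_def, Finsupp.sum, map_sum, coeff_mono, Finsupp.finsetSum_apply]
  rw [Finset.sum_eq_single e₀]
  · rw [Finset.sum_eq_single f₀]
    · rw [Finsupp.single_eq_same]
    · intro f _ hf'
      exact Finsupp.single_eq_of_ne fun h' => hf' (add_left_cancel h').symm
    · intro hf
      rw [Finsupp.single_eq_same, Finsupp.notMem_support_iff.1 hf]
      simp
  · intro e he he'
    refine Finset.sum_eq_zero fun f hf => ?_
    exact Finsupp.single_eq_of_ne fun h' => he' (h he hf h'.symm).1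
  · intro he
    refine Finset.sum_eq_zero fun f hf => ?_
    rw [Finsupp.notMem_support_iff.1 he]
    simp

instance : NoZeroDivisors (WeylAlg q n) where
  eq_zero_or_eq_zero_of_mul_eq_zero {x y} hxy := by
    by_contra! hne
    have hx : (coeff x).support.Nonempty := by simpa using hne.1
    have hy : (coeff y).support.Nonempty := by simpa using hne.2
    obtain ⟨e, he, f, hf, hu⟩ := UniqueSums.uniqueAdd_of_nonempty hx hy
    have h := coeff_mul_of_unique x y e f hu
    rw [hxy, map_zero, Finsupp.zero_apply] at h
    have he' := Finsupp.mem_support_iff.1 he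
    have hf' := Finsupp.mem_support_iff.1 hf
    exact mul_ne_zero (mul_ne_zero he' hf') (twist_ne_zero e f) h.symm

/-- Exponents bounded by `N` in absolute value. -/
noncomputable def box (n N : ℕ) : Finset (WeylExp n) :=
  Fintype.piFinset (fun _ => Finset.Icc (-(N : ℤ)) N) ×ˢ
    Fintype.piFinset (fun _ => Finset.Icc (-(N : ℤ)) N)

theorem mem_box {N : ℕ} {e : WeylExp n} :
    e ∈ box n N ↔ (∀ i, |e.1 i| ≤ N) ∧ ∀ i, |e.2 i| ≤ N := by
  simp [box, abs_le]

theorem card_box (N : ℕ) : (box n N).card = (2 * N + 1) ^ (n + n) := by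
  have h : ((N : ℤ) + 1 + (N : ℤ)).toNat = 2 * N + 1 := by omega
  simp [box, Finset.card_product, h, pow_add]

theorem exists_support_subset_box (x : WeylAlg q n) :
    ∃ m : ℕ, (coeff x).support ⊆ box n m := by
  refine ⟨(coeff x).support.sup fun e => ∑ i, ((e.1 i).natAbs + (e.2 i).natAbs), ?_⟩
  intro e he
  have h1 := Finset.le_sup (f := fun e : WeylExp n => ∑ i, ((e.1 i).natAbs + (e.2 i).natAbs)) he
  have h2 : ∀ i, (e.1 i).natAbs + (e.2 i).natAbs ≤ ∑ i, ((e.1 i).natAbs + (e.2 i).natAbs) :=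
    fun i => Finset.single_le_sum (f := fun i => (e.1 i).natAbs + (e.2 i).natAbs)
      (fun _ _ => Nat.zero_le _) (Finset.mem_univ i)
  rw [mem_box]
  constructor <;> intro i <;> rw [Int.abs_eq_natAbs, Nat.cast_le] <;>
    exact le_trans (le_trans (by omega) (h2 i)) h1

/-- The span of the monomials with exponents bounded by `N`. -/
noncomputable def boxSpan (q : ℂˣ) (n N : ℕ) : Submodule ℂ (WeylAlg q n) :=
  (Finsupp.supported ℂ ℂ (box n N : Set (WeylExp n))).comap (coeff (q := q)).toLinearMap

theorem mem_boxSpan {N : ℕ} {x : WeylAlg q n} :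
    x ∈ boxSpan q n N ↔ (coeff x).support ⊆ box n N := by
  rw [boxSpan, Submodule.mem_comap, Finsupp.mem_supported]
  simp

theorem mul_mem_boxSpan {N m : ℕ} {x y : WeylAlg q n}
    (hx : x ∈ boxSpan q n N) (hy : (coeff y).support ⊆ box n m) :
    x * y ∈ boxSpan q n (N + m) := by
  rw [mem_boxSpan] at hx
  rw [mul_def]
  refine Submodule.sum_mem _ fun e he => Submodule.sum_mem _ fun f hf => ?_
  rw [mem_boxSpan, coeff_mono]
  refine Finsupp.support_single_subset.trans (Finset.singleton_subset_iff.2 ?_)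
  have he' := mem_box.1 (hx he)
  have hf' := mem_box.1 (hy hf)
  refine mem_box.2 ⟨fun i => ?_, fun i => ?_⟩
  · have := abs_add_le (e.1 i) (f.1 i)
    have h1 := he'.1 i
    have h2 := hf'.1 i
    simp only [Prod.fst_add, Pi.add_apply]
    push_cast
    linarith
  · have := abs_add_le (e.2 i) (f.2 i)
    have h1 := he'.2 i
    have h2 := hf'.2 i
    simp only [Prod.snd_add, Pi.add_apply]
    push_cast
    linarith

theorem boxSpan_eq_map (N : ℕ) : boxSpan q n N =
    (Finsupp.supported ℂ ℂ (box n N : Set (WeylExp n))).map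
      (coeff (q := q)).symm.toLinearMap :=
  (Submodule.map_equiv_eq_comap_symm (coeff (q := q)).symm _).symm

instance (N : ℕ) : Module.Finite ℂ (boxSpan q n N) := by
  rw [boxSpan_eq_map]
  have : Module.Finite ℂ (Finsupp.supported ℂ ℂ (box n N : Set (WeylExp n))) :=
    Module.Finite.equiv (Finsupp.supportedEquivFinsupp (R := ℂ) (M := ℂ) _).symm
  infer_instance

theorem finrank_boxSpan (N : ℕ) :
    Module.finrank ℂ (boxSpan q n N) = (2 * N + 1) ^ (n + n) := by
  rw [boxSpan_eq_map, LinearEquiv.finrank_map_eq,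
    (Finsupp.supportedEquivFinsupp (R := ℂ) (M := ℂ) _).finrank_eq,
    Module.finrank_finsupp_self, ← card_box]
  simp

theorem exists_growth (d m : ℕ) : ∃ N : ℕ, (2 * (N + m) + 1) ^ d < 2 * (2 * N + 1) ^ d := by
  by_contra! h
  have hk : ∀ k : ℕ, 2 ^ k ≤ (2 * (k * m) + 1) ^ d := by
    intro k
    induction k with
    | zero => simp
    | succ k ih =>
      calc 2 ^ (k + 1) = 2 * 2 ^ k := by ring
        _ ≤ 2 * (2 * (k * m) + 1) ^ d := by omega
        _ ≤ (2 * (k * m + m) + 1) ^ d := h _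
        _ = (2 * ((k + 1) * m) + 1) ^ d := by ring
  have ht := tendsto_pow_const_div_const_pow_of_one_lt d (r := (2 : ℝ)) (by norm_num)
  have hpos : (0 : ℝ) < 1 / (2 * m + 1 : ℝ) ^ d := by positivity
  obtain ⟨k, hk1, hk2⟩ := ((ht.eventually (gt_mem_nhds hpos)).and
    (Filter.eventually_ge_atTop 1)).exists
  have h1 : ((2 : ℝ)) ^ k ≤ ((2 * m + 1 : ℝ) * k) ^ d := by
    have h2 : (2 : ℝ) ^ k ≤ (2 * (k * m) + 1 : ℝ) ^ d := by exact_mod_cast hk k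
    refine h2.trans (pow_le_pow_left₀ (by positivity) ?_ d)
    have : (1 : ℝ) ≤ k := by exact_mod_cast hk2
    nlinarith
  rw [div_lt_div_iff₀ (by positivity) (by positivity)] at hk1
  rw [mul_pow] at h1
  linarith

theorem exists_ore (r s : WeylAlg q n) (hs : s ≠ 0) :
    ∃ x y : WeylAlg q n, x ≠ 0 ∧ x * r = y * s := by
  obtain ⟨m₁, hm₁⟩ := exists_support_subset_box r
  obtain ⟨m₂, hm₂⟩ := exists_support_subset_box s
  have mono_box : ∀ {a b : ℕ}, a ≤ b → box n a ⊆ box n b := by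
    intro a b hab e he
    have hab' : (a : ℤ) ≤ b := by exact_mod_cast hab
    rw [mem_box] at he ⊢
    exact ⟨fun i => (he.1 i).trans hab', fun i => (he.2 i).trans hab'⟩
  have hr := hm₁.trans (mono_box (le_max_left m₁ m₂))
  have hs' := hm₂.trans (mono_box (le_max_right m₁ m₂))
  set m := max m₁ m₂
  obtain ⟨N, hN⟩ := exists_growth (n + n) m
  let L : (boxSpan q n N × boxSpan q n N) →ₗ[ℂ] boxSpan q n (N + m) :=
    { toFun := fun p => ⟨p.1.1 * r - p.2.1 * s,
        (boxSpan q n (N + m)).sub_mem (mul_mem_boxSpan p.1.2 hr) (mul_mem_boxSpan p.2.2 hs')⟩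
      map_add' := fun p p' => by
        ext1
        simp only [Prod.fst_add, Prod.snd_add, Submodule.coe_add, add_mul]
        abel
      map_smul' := fun c p => by
        ext1
        simp [smul_sub] }
  have hinj : ¬ Function.Injective L := by
    intro hL
    have := LinearMap.finrank_le_finrank_of_injective hL
    rw [Module.finrank_prod, finrank_boxSpan, finrank_boxSpan] at this
    omega
  rw [← LinearMap.ker_eq_bot, Submodule.eq_bot_iff] at hinj
  push Not at hinj
  obtain ⟨⟨x, y⟩, hxy, hne⟩ := hinj
  have hxy' : x.1 * r = y.1 * s := by
    have := congrArg Subtype.val (LinearMap.mem_ker.1 hxy)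
    exact sub_eq_zero.1 this
  refine ⟨x.1, y.1, fun hx => hne ?_, hxy'⟩
  rw [hx, zero_mul] at hxy'
  have hy : y.1 = 0 := (mul_eq_zero.1 hxy'.symm).resolve_right hs
  ext1
  · exact Subtype.ext hx
  · exact Subtype.ext hy

theorem nonempty_oreSet :
    Nonempty (OreLocalization.OreSet (nonZeroDivisors (WeylAlg q n))) := by
  rw [OreLocalization.nonempty_oreSet_iff_of_noZeroDivisors]
  intro r s
  obtain ⟨x, y, hx, h⟩ := exists_ore r s.1 (nonZeroDivisors.coe_ne_zero s)
  exact ⟨y, ⟨x, mem_nonZeroDivisors_of_ne_zero hx⟩, h⟩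

noncomputable instance : OreLocalization.OreSet (nonZeroDivisors (WeylAlg q n)) :=
  Classical.choice nonempty_oreSet

end WeylAlg

/-- Rational functions of the Weyl pairs `u i, w i`: the skew field of fractions of the ultralocal
Weyl algebra. -/
abbrev WeylFrac (q : ℂˣ) (n : ℕ) : Type :=
  OreLocalization (nonZeroDivisors (WeylAlg q n)) (WeylAlg q n)

namespace WeylFrac

/-- `u i` as a rational function. -/
noncomputable def u (q : ℂˣ) {n : ℕ} (i : Fin n) : WeylFrac q n :=
  OreLocalization.numeratorHom (WeylAlg.u q i)

/-- `w i` as a rational function. -/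
noncomputable def w (q : ℂˣ) {n : ℕ} (i : Fin n) : WeylFrac q n :=
  OreLocalization.numeratorHom (WeylAlg.w q i)

/-! In the following, `s` is the chosen square root of `q`, and `κ i` is the coupling constant at
vertex `i`. -/

/-- `Λ₁` for the vertices `i, j, k` in place of `1, 2, 3`. -/
noncomputable def Lam1 (q s : ℂˣ) {n : ℕ} (κ : Fin n → ℂˣ) (i j k : Fin n) : WeylFrac q n :=
  (u q i)⁻¹ * u q k - (s : ℂ) • ((u q i)⁻¹ * w q i) + (κ i : ℂ) • (w q i * (u q j)⁻¹)

/-- `Λ₂` for the vertices `i, j, k` in place of `1, 2, 3`. -/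
noncomputable def Lam2 (q s : ℂˣ) {n : ℕ} (κ : Fin n → ℂˣ) (i j k : Fin n) : WeylFrac q n :=
  ((κ i : ℂ) / κ j) • ((u q j)⁻¹ * (w q k)⁻¹) + ((κ k : ℂ) / κ j) • ((u q i)⁻¹ * (w q j)⁻¹)
    - ((κ i : ℂ) * κ k / (s * κ j)) • ((u q j)⁻¹ * (w q j)⁻¹)

/-- `Λ₃` for the vertices `i, j, k` in place of `1, 2, 3`. -/
noncomputable def Lam3 (q s : ℂˣ) {n : ℕ} (κ : Fin n → ℂˣ) (i j k : Fin n) : WeylFrac q n :=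
  w q i * (w q k)⁻¹ - (s : ℂ) • (u q k * (w q k)⁻¹) + (κ k : ℂ) • ((w q j)⁻¹ * u q k)

/-- `R` is the mapping `R_{ijk}`: the automorphism of the skew field of rational functions that
sends every generator `u i, w i` to its primed counterpart, and so `Φ(u, w)` to `Φ(u', w')`; it does
not touch the pairs at the other vertices. -/
structure IsR (q s : ℂˣ) {n : ℕ} (κ : Fin n → ℂˣ) (i j k : Fin n)
    (R : WeylFrac q n ≃ₐ[ℂ] WeylFrac q n) : Prop where
  map_w₁ : R (w q i) = w q j * Lam3 q s κ i j k
  map_w₂ : R (w q j) = (Lam3 q s κ i j k)⁻¹ * w q i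
  map_w₃ : R (w q k) = (Lam2 q s κ i j k)⁻¹ * (u q i)⁻¹
  map_u₁ : R (u q i) = (Lam2 q s κ i j k)⁻¹ * (w q k)⁻¹
  map_u₂ : R (u q j) = (Lam1 q s κ i j k)⁻¹ * u q k
  map_u₃ : R (u q k) = u q j * Lam1 q s κ i j k
  map_w_of_ne : ∀ l, l ≠ i → l ≠ j → l ≠ k → R (w q l) = w q l
  map_u_of_ne : ∀ l, l ≠ i → l ≠ j → l ≠ k → R (u q l) = u q l

end WeylFrac

/-! Existence. The prescribed images again satisfy the Weyl relations (`IsWeyl.flip`), so they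
define a homomorphism from the Weyl algebra to its skew field (`IsWeyl.lift`). Three identities,
linear in `u i`, `(w i)⁻¹` and `(u k)⁻¹`, show that its range contains every generator or its
inverse (`IsWeyl.mem_range_lift_flip`). Such a homomorphism is injective by growth of dimension: a
nonzero kernel would make the images of boxes of exponents too small to hold all the monomials known
to lie in them (`WeylAlg.injective_of_mono_mem_range`). It therefore extends to fractions, and the
range of the extension is a division algebra containing all generators, hence everything. Uniqueness
is clear, since the generators determine a homomorphism.

Tetrahedron equation. The fourfold compositions are never computed. Consider four lines in general
position; their six intersection points carry the Weyl pairs, and each point carries a linear form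
on its four adjacent faces, with coefficients `w`, `s u`, `κ u w`, `1` (`corner`). Forms are
combined with coefficients on the right. Moving a line across the intersection of two others
reverses a triangle, and `R i j k` is the change of pairs under which the combinations that vanish
on the triangle are exactly the combinations for the reversed triangle that vanish on that one
(`IsWeyl.exists_triRel`, `IsWeyl.exists_triRel'`). Faces are labelled by their sides of the lines,
so combinations for different arrangements are functions on the same sixteen labels.

Both sides of the equation lead from one arrangement to the same final one, reversing the four
triangles in opposite orders. Hence the two resulting families of pairs have the same combinations
among the functions that vanish at every face bounded at some stage. These functions determine the
pairs (`IsWeyl.eq_of_faceRel`), so the two automorphisms agree on generators. -/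

/-- Two families in a division algebra that satisfy the relations of `n` Weyl pairs. -/
structure IsWeyl (q : ℂˣ) {n : ℕ} {D : Type*} [DivisionRing D] [Algebra ℂ D] (u w : Fin n → D) :
    Prop where
  u_ne_zero : ∀ i, u i ≠ 0
  w_ne_zero : ∀ i, w i ≠ 0
  u_mul_u : ∀ i j, u i * u j = u j * u i
  w_mul_w : ∀ i j, w i * w j = w j * w i
  u_mul_w_self : ∀ i, u i * w i = (q : ℂ) • (w i * u i)
  u_mul_w_of_ne : ∀ i j, i ≠ j → u i * w j = w j * u i

/-! ### Homomorphisms out of the Weyl algebra and out of its skew field -/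

section lift

variable {q : ℂˣ} {n : ℕ} {D E : Type*} [DivisionRing D] [Algebra ℂ D] [DivisionRing E]
  [Algebra ℂ E]

theorem zpowersHom_commute {n : ℕ} {D : Type*} [DivisionRing D] (x : Fin n → D)
    (hx : ∀ i, x i ≠ 0) (hc : ∀ i j, x i * x j = x j * x i) :
    Pairwise fun i j => ∀ a b : Multiplicative ℤ,
      Commute (zpowersHom Dˣ (Units.mk0 (x i) (hx i)) a)
        (zpowersHom Dˣ (Units.mk0 (x j) (hx j)) b) := by
  intro i j _ a b
  simp only [zpowersHom_apply]
  exact Commute.zpow_zpow (Units.ext (hc i j)) _ _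

/-- The product of the powers `x i ^ a i` of a commuting family of nonzero elements. -/
noncomputable def zpowProd (x : Fin n → D) (hx : ∀ i, x i ≠ 0)
    (hc : ∀ i j, x i * x j = x j * x i) : Multiplicative (Fin n → ℤ) →* Dˣ :=
  (MonoidHom.noncommPiCoprod (fun i => zpowersHom Dˣ (Units.mk0 (x i) (hx i)))
    (zpowersHom_commute x hx hc)).comp
    (MulEquiv.piMultiplicative (fun _ : Fin n => ℤ)).toMonoidHom

theorem zpowProd_single {n : ℕ} {D : Type*} [DivisionRing D] (x : Fin n → D)
    (hx : ∀ i, x i ≠ 0) (hc : ∀ i j, x i * x j = x j * x i) (i : Fin n) (a : ℤ) :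
    zpowProd x hx hc (Multiplicative.ofAdd (Pi.single i a)) = Units.mk0 (x i) (hx i) ^ a := by
  have h : (MulEquiv.piMultiplicative (fun _ : Fin n => ℤ))
      (Multiplicative.ofAdd (Pi.single i a)) = Pi.mulSingle i (Multiplicative.ofAdd a) := by
    funext j
    by_cases hj : j = i
    · subst hj; simp [MulEquiv.piMultiplicative]
    · simp [MulEquiv.piMultiplicative, hj]
  simp only [zpowProd, MonoidHom.comp_apply, MulEquiv.toMonoidHom_eq_coe, MonoidHom.coe_coe]
  rw [h, MonoidHom.noncommPiCoprod_mulSingle]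
  simp

theorem zpow_mul_zpow_of_q_comm {c : ℂˣ} {x y : D} (hx : x ≠ 0) (hy : y ≠ 0)
    (h : x * y = (c : ℂ) • (y * x)) (a b : ℤ) :
    y ^ b * x ^ a = ((c ^ (-(b * a)) : ℂˣ) : ℂ) • (x ^ a * y ^ b) := by
  have key : ∀ (c : ℂˣ) (x y : D), x ≠ 0 → y ≠ 0 → x * y = (c : ℂ) • (y * x) → ∀ a : ℤ,
      x ^ a * y = ((c ^ a : ℂˣ) : ℂ) • (y * x ^ a) := by
    intro c x y hx hy h a
    induction a using Int.induction_on with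
    | zero => simp
    | succ i ih =>
      rw [zpow_add_one₀ hx, mul_assoc, h, mul_smul_comm, ← mul_assoc, ih, smul_mul_assoc,
        smul_smul, mul_assoc, zpow_add_one]
      push_cast
      rw [mul_comm]
    | pred i ih =>
      have h' : x⁻¹ * y = ((c⁻¹ : ℂˣ) : ℂ) • (y * x⁻¹) := by
        have h1 : y * x = ((c⁻¹ : ℂˣ) : ℂ) • (x * y) := by rw [h, smul_smul]; simp
        have h2 : x⁻¹ * (y * x) * x⁻¹ = x⁻¹ * (((c⁻¹ : ℂˣ) : ℂ) • (x * y)) * x⁻¹ := by rw [h1]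
        have h3 : x⁻¹ * (y * x) * x⁻¹ = x⁻¹ * y := by
          rw [← mul_assoc, mul_assoc, mul_inv_cancel₀ hx, mul_one]
        rw [h3] at h2
        rw [h2, mul_smul_comm, smul_mul_assoc, ← mul_assoc, inv_mul_cancel₀ hx, one_mul]
      rw [zpow_sub_one₀ hx, mul_assoc, h', mul_smul_comm, ← mul_assoc, ih, smul_mul_assoc,
        smul_smul, mul_assoc, zpow_sub_one]
      push_cast
      rw [mul_comm]
  have h1 : y * x ^ a = ((c ^ (-a) : ℂˣ) : ℂ) • (x ^ a * y) := by
    rw [key c x y hx hy h a, smul_smul, ← Units.val_mul, ← zpow_add]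
    simp
  -- `key` is used a second time, to move powers of `y` past the fixed element `x ^ a` with constant
  -- `c ^ (-a)`.
  rw [key (c ^ (-a)) y (x ^ a) hy (zpow_ne_zero _ hx) h1 b, ← zpow_mul]
  congr 3
  ring

theorem IsWeyl.zpowProd_comm {u w : Fin n → D} (h : IsWeyl q u w) (a b : Fin n → ℤ) :
    (zpowProd w h.w_ne_zero h.w_mul_w (Multiplicative.ofAdd b) : D) *
        zpowProd u h.u_ne_zero h.u_mul_u (Multiplicative.ofAdd a) =
      ((q ^ (-(∑ i, b i * a i)) : ℂˣ) : ℂ) •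
        ((zpowProd u h.u_ne_zero h.u_mul_u (Multiplicative.ofAdd a) : D) *
        zpowProd w h.w_ne_zero h.w_mul_w (Multiplicative.ofAdd b)) := by
  induction a using Pi.single_induction with
  | zero => simp
  | add f g hf hg =>
    rw [ofAdd_add, map_mul, Units.val_mul, ← mul_assoc, hf, smul_mul_assoc, mul_assoc, hg,
      mul_smul_comm, smul_smul, mul_assoc, ← Units.val_mul, ← zpow_add]
    congr 4
    simp [mul_add, Finset.sum_add_distrib]
    ring
  | single i m =>
    induction b using Pi.single_induction with
    | zero => simp
    | add f g hf hg =>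
      rw [ofAdd_add, map_mul, Units.val_mul, mul_assoc, hg, mul_smul_comm, ← mul_assoc, hf,
        smul_mul_assoc, smul_smul, mul_assoc, ← Units.val_mul, ← zpow_add]
      congr 4
      simp [add_mul, Finset.sum_add_distrib]
    | single j k =>
      rw [zpowProd_single, zpowProd_single]
      simp only [Units.val_zpow_eq_zpow_val, Units.val_mk0]
      by_cases hij : i = j
      · subst hij
        rw [zpow_mul_zpow_of_q_comm (h.u_ne_zero i) (h.w_ne_zero i) (h.u_mul_w_self i)]
        simp [Pi.single_apply]
      · rw [zpow_mul_zpow_of_q_comm (c := 1) (h.u_ne_zero i) (h.w_ne_zero j)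
          (by simpa using h.u_mul_w_of_ne i j hij)]
        simp [Pi.single_apply, hij]

/-- The value of the ordered monomial `u ^ a * w ^ b`, `e = (a, b)`, at a family of Weyl pairs. -/
noncomputable def IsWeyl.monoVal {u w : Fin n → D} (h : IsWeyl q u w) (e : WeylExp n) : D :=
  zpowProd u h.u_ne_zero h.u_mul_u (Multiplicative.ofAdd e.1) *
    zpowProd w h.w_ne_zero h.w_mul_w (Multiplicative.ofAdd e.2)

theorem IsWeyl.monoVal_mul {u w : Fin n → D} (h : IsWeyl q u w) (e f : WeylExp n) :
    h.monoVal e * h.monoVal f = WeylAlg.twist q e f • h.monoVal (e + f) := by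
  simp only [monoVal, Prod.fst_add, Prod.snd_add, ofAdd_add, map_mul, Units.val_mul]
  rw [mul_assoc, ← mul_assoc (zpowProd w _ _ _ : D), h.zpowProd_comm]
  simp only [smul_mul_assoc, mul_smul_comm, mul_assoc, WeylAlg.twist]

/-- The homomorphism from the Weyl algebra given by a family of Weyl pairs, as a linear map. -/
noncomputable def IsWeyl.liftLinear {u w : Fin n → D} (h : IsWeyl q u w) : WeylAlg q n →ₗ[ℂ] D :=
  (Finsupp.linearCombination ℂ h.monoVal).comp (WeylAlg.coeff (q := q)).toLinearMap

theorem IsWeyl.liftLinear_mono {u w : Fin n → D} (h : IsWeyl q u w) (e : WeylExp n) (x : ℂ) :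
    h.liftLinear (WeylAlg.mono q e x) = x • h.monoVal e := by
  simp [liftLinear, WeylAlg.coeff_mono]

/-- The homomorphism from the Weyl algebra given by a family of Weyl pairs. -/
noncomputable def IsWeyl.lift {u w : Fin n → D} (h : IsWeyl q u w) : WeylAlg q n →ₐ[ℂ] D :=
  AlgHom.ofLinearMap h.liftLinear
    (by
      rw [WeylAlg.one_def, h.liftLinear_mono]
      simp only [monoVal, Prod.fst_zero, Prod.snd_zero, ofAdd_zero, map_one, Units.val_one]
      simp)
    (fun x y => by
      induction x using WeylAlg.induction_on with
      | h0 => simp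
      | hadd x₁ x₂ h₁ h₂ => simp only [add_mul, map_add, h₁, h₂]
      | hm e a =>
        induction y using WeylAlg.induction_on with
        | h0 => simp
        | hadd y₁ y₂ h₁ h₂ => simp only [mul_add, map_add, h₁, h₂]
        | hm f b =>
          rw [WeylAlg.mono_mul_mono, h.liftLinear_mono, h.liftLinear_mono, h.liftLinear_mono,
            smul_mul_smul_comm, h.monoVal_mul, smul_smul])

theorem IsWeyl.lift_mono {u w : Fin n → D} (h : IsWeyl q u w) (e : WeylExp n) (x : ℂ) :
    h.lift (WeylAlg.mono q e x) = x • h.monoVal e := h.liftLinear_mono e x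

theorem IsWeyl.lift_u {u w : Fin n → D} (h : IsWeyl q u w) (i : Fin n) :
    h.lift (WeylAlg.u q i) = u i := by
  rw [WeylAlg.u, h.lift_mono, monoVal, zpowProd_single]
  simp

theorem IsWeyl.lift_w {u w : Fin n → D} (h : IsWeyl q u w) (i : Fin n) :
    h.lift (WeylAlg.w q i) = w i := by
  rw [WeylAlg.w, h.lift_mono, monoVal, zpowProd_single]
  simp

theorem WeylAlg.mono_ne_zero (e : WeylExp n) : mono q e 1 ≠ 0 := by
  intro h
  have := congrArg coeff h
  rw [coeff_mono, map_zero] at this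
  simp at this

namespace WeylFrac

/-- The inclusion of the Weyl algebra into its skew field of fractions. -/
noncomputable def ofAlg (q : ℂˣ) (n : ℕ) : WeylAlg q n →ₐ[ℂ] WeylFrac q n :=
  { (OreLocalization.numeratorRingHom : WeylAlg q n →+* WeylFrac q n) with
    commutes' := fun _ => rfl }

theorem ofAlg_injective : Function.Injective (ofAlg q n) :=
  OreLocalization.numeratorHom_inj fun _ h => h.1

theorem ofAlg_u (i : Fin n) : ofAlg q n (WeylAlg.u q i) = u q i := rfl

theorem ofAlg_w (i : Fin n) : ofAlg q n (WeylAlg.w q i) = w q i := rfl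

theorem isWeyl (q : ℂˣ) (n : ℕ) : IsWeyl q (u q : Fin n → WeylFrac q n) (w q) where
  u_ne_zero i := by
    rw [← ofAlg_u, map_ne_zero_iff _ ofAlg_injective]
    exact WeylAlg.mono_ne_zero _
  w_ne_zero i := by
    rw [← ofAlg_w, map_ne_zero_iff _ ofAlg_injective]
    exact WeylAlg.mono_ne_zero _
  u_mul_u i j := by simp only [← ofAlg_u, ← map_mul, WeylAlg.u_mul_u i j]
  w_mul_w i j := by simp only [← ofAlg_w, ← map_mul, WeylAlg.w_mul_w i j]
  u_mul_w_self i := by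
    simp only [← ofAlg_u, ← ofAlg_w, ← map_mul, WeylAlg.u_mul_w i i, map_smul]
    simp
  u_mul_w_of_ne i j hij := by
    simp only [← ofAlg_u, ← ofAlg_w, ← map_mul, WeylAlg.u_mul_w i j]
    simp [hij]

theorem exists_eq_inv_mul (x : WeylFrac q n) :
    ∃ r s : WeylAlg q n, s ≠ 0 ∧ x = (ofAlg q n s)⁻¹ * ofAlg q n r := by
  induction x using OreLocalization.ind with
  | _ r s =>
    have hs := nonZeroDivisors.coe_ne_zero s
    refine ⟨r, s, hs, ?_⟩
    have hs' : ofAlg q n s ≠ 0 := (map_ne_zero_iff _ ofAlg_injective).2 hs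
    rw [eq_inv_mul_iff_mul_eq₀ hs']
    exact OreLocalization.mul_cancel

end WeylFrac

theorem IsWeyl.map {u w : Fin n → D} (h : IsWeyl q u w) (f : D →ₐ[ℂ] E) :
    IsWeyl q (fun i => f (u i)) (fun i => f (w i)) where
  u_ne_zero i := (map_ne_zero f).2 (h.u_ne_zero i)
  w_ne_zero i := (map_ne_zero f).2 (h.w_ne_zero i)
  u_mul_u i j := by simp only [← map_mul, h.u_mul_u i j]
  w_mul_w i j := by simp only [← map_mul, h.w_mul_w i j]
  u_mul_w_self i := by simp only [← map_mul, h.u_mul_w_self i, map_smul]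
  u_mul_w_of_ne i j hij := by simp only [← map_mul, h.u_mul_w_of_ne i j hij]

theorem map_mono_u (f : WeylAlg q n →ₐ[ℂ] D) (hf : ∀ i, f (WeylAlg.u q i) ≠ 0) (i : Fin n)
    (m : ℤ) : f (WeylAlg.mono q (Pi.single i m, 0) 1) = f (WeylAlg.u q i) ^ m := by
  have hadd : ∀ k l : ℤ, WeylAlg.mono q (Pi.single i (k + l), (0 : Fin n → ℤ)) 1 =
      WeylAlg.mono q (Pi.single i k, 0) 1 * WeylAlg.mono q (Pi.single i l, 0) 1 := by
    intro k l
    simp [WeylAlg.mono_mul_mono, WeylAlg.twist, Pi.single_add]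
  have h0 : WeylAlg.mono q ((Pi.single i 0 : Fin n → ℤ), (0 : Fin n → ℤ)) 1 = 1 := by
    rw [Pi.single_zero]; rfl
  induction m using Int.induction_on with
  | zero => rw [h0]; simp
  | succ k ih => rw [hadd, map_mul, ih, zpow_add_one₀ (hf i)]; rfl
  | pred k ih =>
    rw [zpow_sub_one₀ (hf i), ← ih, eq_mul_inv_iff_mul_eq₀ (hf i)]
    have := hadd (-(k : ℤ) - 1) 1
    rw [sub_add_cancel] at this
    rw [this, map_mul]; rfl

theorem map_mono_w (f : WeylAlg q n →ₐ[ℂ] D) (hf : ∀ i, f (WeylAlg.w q i) ≠ 0) (i : Fin n)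
    (m : ℤ) : f (WeylAlg.mono q (0, Pi.single i m) 1) = f (WeylAlg.w q i) ^ m := by
  have hadd : ∀ k l : ℤ, WeylAlg.mono q ((0 : Fin n → ℤ), Pi.single i (k + l)) 1 =
      WeylAlg.mono q (0, Pi.single i k) 1 * WeylAlg.mono q (0, Pi.single i l) 1 := by
    intro k l
    simp [WeylAlg.mono_mul_mono, WeylAlg.twist, Pi.single_add]
  have h0 : WeylAlg.mono q ((0 : Fin n → ℤ), (Pi.single i 0 : Fin n → ℤ)) 1 = 1 := by
    rw [Pi.single_zero]; rfl
  induction m using Int.induction_on with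
  | zero => rw [h0]; simp
  | succ k ih => rw [hadd, map_mul, ih, zpow_add_one₀ (hf i)]; rfl
  | pred k ih =>
    rw [zpow_sub_one₀ (hf i), ← ih, eq_mul_inv_iff_mul_eq₀ (hf i)]
    have := hadd (-(k : ℤ) - 1) 1
    rw [sub_add_cancel] at this
    rw [this, map_mul]; rfl

/-- The generators determine a homomorphism. This gives uniqueness of `R` through `algHom_ext`, and
identifies the inclusion `ofAlg` with a lift. -/
theorem IsWeyl.map_mono {u w : Fin n → D} (h : IsWeyl q u w) (f : WeylAlg q n →ₐ[ℂ] D)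
    (hu : ∀ i, f (WeylAlg.u q i) = u i) (hw : ∀ i, f (WeylAlg.w q i) = w i) (e : WeylExp n)
    (x : ℂ) : f (WeylAlg.mono q e x) = x • h.monoVal e := by
  obtain ⟨a, b⟩ := e
  have hab : WeylAlg.mono q (a, b) x =
      x • (WeylAlg.mono q (a, 0) 1 * WeylAlg.mono q (0, b) 1) := by
    simp [WeylAlg.mono_mul_mono, WeylAlg.twist, WeylAlg.smul_mono]
  rw [hab, map_smul, map_mul, IsWeyl.monoVal]
  congr 2
  · clear hab
    induction a using Pi.single_induction with
    | zero =>
      have : WeylAlg.mono q ((0 : Fin n → ℤ), (0 : Fin n → ℤ)) 1 = 1 := rfl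
      simp [this]
    | add g g' hg hg' =>
      have : WeylAlg.mono q (g + g', (0 : Fin n → ℤ)) 1 =
          WeylAlg.mono q (g, 0) 1 * WeylAlg.mono q (g', 0) 1 := by
        simp [WeylAlg.mono_mul_mono, WeylAlg.twist]
      rw [this, map_mul, hg, hg', ofAdd_add, map_mul, Units.val_mul]
    | single i m =>
      rw [map_mono_u f (fun i => hu i ▸ h.u_ne_zero i), zpowProd_single]
      simp [hu]
  · clear hab
    induction b using Pi.single_induction with
    | zero =>
      have : WeylAlg.mono q ((0 : Fin n → ℤ), (0 : Fin n → ℤ)) 1 = 1 := rfl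
      simp [this]
    | add g g' hg hg' =>
      have : WeylAlg.mono q ((0 : Fin n → ℤ), g + g') 1 =
          WeylAlg.mono q (0, g) 1 * WeylAlg.mono q (0, g') 1 := by
        simp [WeylAlg.mono_mul_mono, WeylAlg.twist]
      rw [this, map_mul, hg, hg', ofAdd_add, map_mul, Units.val_mul]
    | single i m =>
      rw [map_mono_w f (fun i => hw i ▸ h.w_ne_zero i), zpowProd_single]
      simp [hw]

namespace WeylFrac

theorem algHom_ext {f g : WeylFrac q n →ₐ[ℂ] D} (hu : ∀ i, f (u q i) = g (u q i))
    (hw : ∀ i, f (w q i) = g (w q i)) : f = g := by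
  have key : ∀ x : WeylAlg q n, f (ofAlg q n x) = g (ofAlg q n x) := by
    have hg := (isWeyl q n).map g
    intro x
    induction x using WeylAlg.induction_on with
    | h0 => simp
    | hadd x y hx hy => simp only [map_add, hx, hy]
    | hm e a =>
      exact (hg.map_mono (f.comp (ofAlg q n)) hu hw e a).trans
        (hg.map_mono (g.comp (ofAlg q n)) (fun _ => rfl) (fun _ => rfl) e a).symm
  ext x
  obtain ⟨r, s, -, rfl⟩ := exists_eq_inv_mul x
  rw [map_mul, map_mul, map_inv₀, map_inv₀, key, key]

/-- The extension of an injective homomorphism from the Weyl algebra to its skew field of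
fractions. -/
theorem exists_extension (f : WeylAlg q n →ₐ[ℂ] D) (hf : Function.Injective f) :
    ∃ F : WeylFrac q n →ₐ[ℂ] D, ∀ x, F (ofAlg q n x) = f x := by
  have hne : ∀ s : nonZeroDivisors (WeylAlg q n), f s ≠ 0 := fun s =>
    (map_ne_zero_iff f hf).2 (nonZeroDivisors.coe_ne_zero s)
  let fS : nonZeroDivisors (WeylAlg q n) →* Dˣ :=
    { toFun := fun s => Units.mk0 (f s) (hne s)
      map_one' := by ext; simp
      map_mul' := fun s t => by ext; simp }
  let F := OreLocalization.universalHom (f : WeylAlg q n →+* D) fS (fun _ => rfl)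
  have hF : ∀ x, F (ofAlg q n x) = f x := fun x =>
    OreLocalization.universalHom_commutes (f : WeylAlg q n →+* D) fS (fun _ => rfl)
  refine ⟨{ F with commutes' := fun c => ?_ }, hF⟩
  have := hF (algebraMap ℂ _ c)
  rwa [AlgHom.commutes, AlgHom.commutes] at this

end WeylFrac

end lift

/-! ### The images of the pairs under one mapping: Weyl relations and inversion identities -/

section flip

variable {q s : ℂˣ} {n : ℕ} {D E : Type*} [DivisionRing D] [Algebra ℂ D] [DivisionRing E]
  [Algebra ℂ E] {u w : Fin n → D} {i j k : Fin n}

/-- Pairwise distinct vertices of a triangle. -/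
structure Distinct (i j k : Fin n) : Prop where
  ij : i ≠ j
  ik : i ≠ k
  jk : j ≠ k

/-- The ordered monomial in the Weyl pairs at the vertices `i, j, k`. -/
noncomputable def IsWeyl.mon (h : IsWeyl q u w) (i j k : Fin n) (a b c d e f : ℤ) : D :=
  h.monoVal (Pi.single i a + Pi.single j b + Pi.single k c,
    Pi.single i d + Pi.single j e + Pi.single k f)

/-- With this product rule every polynomial identity among the six generators of a triangle becomes
a comparison of coefficients of ordered monomials. -/
theorem IsWeyl.mon_mul (h : IsWeyl q u w) (hs : s ^ 2 = q) (hd : Distinct i j k)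
    (a b c d e f a' b' c' d' e' f' : ℤ) :
    h.mon i j k a b c d e f * h.mon i j k a' b' c' d' e' f' =
      (s : ℂ) ^ (-2 * (d * a' + e * b' + f * c')) •
        h.mon i j k (a + a') (b + b') (c + c') (d + d') (e + e') (f + f') := by
  rw [mon, mon, h.monoVal_mul, mon]
  congr 1
  · simp [WeylAlg.twist, add_mul, mul_add, Finset.sum_add_distrib, Pi.single_apply, hd.ij, hd.ik,
      hd.jk, hd.ij.symm, hd.ik.symm, hd.jk.symm]
    rw [← hs, Units.val_pow_eq_pow_val, ← zpow_natCast, ← zpow_mul]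
    congr 1
    push_cast
    ring
  · congr 1
    simp only [Prod.mk_add_mk, Pi.single_add]
    ext1 <;> (simp only; abel)

theorem IsWeyl.mon_eqs (h : IsWeyl q u w) :
    u i = h.mon i j k 1 0 0 0 0 0 ∧ u j = h.mon i j k 0 1 0 0 0 0 ∧
    u k = h.mon i j k 0 0 1 0 0 0 ∧ w i = h.mon i j k 0 0 0 1 0 0 ∧
    w j = h.mon i j k 0 0 0 0 1 0 ∧ w k = h.mon i j k 0 0 0 0 0 1 ∧
    (u i)⁻¹ = h.mon i j k (-1) 0 0 0 0 0 ∧ (u j)⁻¹ = h.mon i j k 0 (-1) 0 0 0 0 ∧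
    (u k)⁻¹ = h.mon i j k 0 0 (-1) 0 0 0 ∧ (w i)⁻¹ = h.mon i j k 0 0 0 (-1) 0 0 ∧
    (w j)⁻¹ = h.mon i j k 0 0 0 0 (-1) 0 ∧ (w k)⁻¹ = h.mon i j k 0 0 0 0 0 (-1) := by
  simp [mon, monoVal, zpowProd_single]

/-- `Λ₁` at a family of Weyl pairs. -/
noncomputable def lam1 (s : ℂˣ) (κ : Fin n → ℂˣ) (u w : Fin n → D) (i j k : Fin n) : D :=
  (u i)⁻¹ * u k - (s : ℂ) • ((u i)⁻¹ * w i) + (κ i : ℂ) • (w i * (u j)⁻¹)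

/-- `Λ₂` at a family of Weyl pairs. -/
noncomputable def lam2 (s : ℂˣ) (κ : Fin n → ℂˣ) (u w : Fin n → D) (i j k : Fin n) : D :=
  ((κ i : ℂ) / κ j) • ((u j)⁻¹ * (w k)⁻¹) + ((κ k : ℂ) / κ j) • ((u i)⁻¹ * (w j)⁻¹)
    - ((κ i : ℂ) * κ k / (s * κ j)) • ((u j)⁻¹ * (w j)⁻¹)

/-- `Λ₃` at a family of Weyl pairs. -/
noncomputable def lam3 (s : ℂˣ) (κ : Fin n → ℂˣ) (u w : Fin n → D) (i j k : Fin n) : D :=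
  w i * (w k)⁻¹ - (s : ℂ) • (u k * (w k)⁻¹) + (κ k : ℂ) • ((w j)⁻¹ * u k)

theorem IsWeyl.lam_eqs (h : IsWeyl q u w) (hs : s ^ 2 = q) (hd : Distinct i j k)
    (κ : Fin n → ℂˣ) :
    lam1 s κ u w i j k = h.mon i j k (-1) 0 1 0 0 0 - (s : ℂ) • h.mon i j k (-1) 0 0 1 0 0 +
      (κ i : ℂ) • h.mon i j k 0 (-1) 0 1 0 0 ∧
    lam2 s κ u w i j k = ((κ i : ℂ) / κ j) • h.mon i j k 0 (-1) 0 0 0 (-1) +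
      ((κ k : ℂ) / κ j) • h.mon i j k (-1) 0 0 0 (-1) 0 -
      ((κ i : ℂ) * κ k / (s * κ j)) • h.mon i j k 0 (-1) 0 0 (-1) 0 ∧
    lam3 s κ u w i j k = h.mon i j k 0 0 0 1 0 (-1) - (s : ℂ) • h.mon i j k 0 0 1 0 0 (-1) +
      (κ k : ℂ) • h.mon i j k 0 0 1 0 (-1) 0 := by
  obtain ⟨e1, e2, e3, e4, e5, e6, e7, e8, e9, e10, e11, e12⟩ :=
    h.mon_eqs (i := i) (j := j) (k := k)
  simp only [lam1, lam2, lam3, e7, e8, e11, e12]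
  simp only [e3, e4, h.mon_mul hs hd]
  norm_num

/-- `x * y = q ^ m * y * x`. -/
def QComm (q : ℂˣ) (m : ℤ) (x y : D) : Prop := x * y = ((q ^ m : ℂˣ) : ℂ) • (y * x)

theorem QComm.symm {m : ℤ} {x y : D} (h : QComm q m x y) : QComm q (-m) y x := by
  unfold QComm at *
  rw [h, smul_smul, ← Units.val_mul, ← zpow_add]
  simp

theorem QComm.mul_left {m m' : ℤ} {x x' y : D} (h : QComm q m x y) (h' : QComm q m' x' y) :
    QComm q (m + m') (x * x') y := by
  unfold QComm at *
  rw [mul_assoc, h', mul_smul_comm, ← mul_assoc, h, smul_mul_assoc, smul_smul, mul_assoc,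
    ← Units.val_mul, ← zpow_add, add_comm]

theorem QComm.inv_left {m : ℤ} {x y : D} (h : QComm q m x y) : QComm q (-m) x⁻¹ y := by
  by_cases hx : x = 0
  · simp [QComm, hx]
  have h' := h.symm
  unfold QComm at *
  have h2 : x⁻¹ * (y * x) * x⁻¹ = x⁻¹ * y := by
    rw [← mul_assoc, mul_assoc, mul_inv_cancel₀ hx, mul_one]
  rw [← h2, h', mul_smul_comm, smul_mul_assoc, ← mul_assoc, inv_mul_cancel₀ hx, one_mul]

theorem QComm.mul_right {m m' : ℤ} {x y y' : D} (h : QComm q m x y) (h' : QComm q m' x y') :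
    QComm q (m + m') x (y * y') := by
  have := (h.symm.mul_left h'.symm).symm
  rwa [← neg_add, neg_neg] at this

theorem QComm.inv_right {m : ℤ} {x y : D} (h : QComm q m x y) : QComm q (-m) x y⁻¹ := by
  simpa using h.symm.inv_left.symm

theorem QComm.cast {m m' : ℤ} {x y : D} (h : QComm q m x y) (hm : m = m') : QComm q m' x y :=
  hm ▸ h

theorem qComm_zero {x y : D} : QComm q 0 x y ↔ x * y = y * x := by simp [QComm]

theorem qComm_one {x y : D} : QComm q 1 x y ↔ x * y = (q : ℂ) • (y * x) := by simp [QComm]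

/-- These three monomials, together with `w j * lam3`, `u j * lam1` and `u i * lam2`, generate all
six images. The Weyl relations of the images follow from the table of `q`-commutations of these six
elements, given here and in the next two lemmas. -/
theorem IsWeyl.qComm_monomials (h : IsWeyl q u w) (hs : s ^ 2 = q) (hd : Distinct i j k) :
    QComm q (-1) (w j * w i) (u j * u k) ∧ QComm q (-1) (w j * w i) (u i * (w k)⁻¹) ∧
    QComm q (-1) (u j * u k) (u i * (w k)⁻¹) := by
  obtain ⟨e1, e2, e3, e4, e5, e6, e7, e8, e9, e10, e11, e12⟩ :=
    h.mon_eqs (i := i) (j := j) (k := k)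
  have hq : (q : ℂ) = (s : ℂ) ^ 2 := by rw [← hs]; simp
  rw [e12, e1, e2, e3, e4, e5]
  simp only [QComm, zpow_neg, zpow_one, Units.val_inv_eq_inv_val, h.mon_mul hs hd, smul_smul, hq,
    mul_smul_comm, smul_mul_assoc]
  norm_num

theorem IsWeyl.qComm_lam_monomials (h : IsWeyl q u w) (hs : s ^ 2 = q) (hd : Distinct i j k)
    (κ : Fin n → ℂˣ) :
    QComm q 0 (w j * lam3 s κ u w i j k) (w j * w i) ∧
    QComm q 0 (w j * lam3 s κ u w i j k) (u j * u k) ∧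
    QComm q (-1) (w j * lam3 s κ u w i j k) (u i * (w k)⁻¹) ∧
    QComm q 0 (u j * lam1 s κ u w i j k) (w j * w i) ∧
    QComm q 0 (u j * lam1 s κ u w i j k) (u j * u k) ∧
    QComm q (-1) (u j * lam1 s κ u w i j k) (u i * (w k)⁻¹) ∧
    QComm q 0 (u i * lam2 s κ u w i j k) (w j * w i) ∧
    QComm q 1 (u i * lam2 s κ u w i j k) (u j * u k) ∧
    QComm q 0 (u i * lam2 s κ u w i j k) (u i * (w k)⁻¹) := by
  obtain ⟨e1, e2, e3, e4, e5, e6, e7, e8, e9, e10, e11, e12⟩ :=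
    h.mon_eqs (i := i) (j := j) (k := k)
  obtain ⟨l1, l2, l3⟩ := h.lam_eqs hs hd κ
  have hq : (q : ℂ) = (s : ℂ) ^ 2 := by rw [← hs]; simp
  rw [l1, l2, l3, e12, e1, e2, e3, e4, e5]
  simp only [QComm, zpow_neg, zpow_one, zpow_zero, Units.val_one,
    Units.val_inv_eq_inv_val, mul_add, add_mul, mul_sub, sub_mul, smul_mul_assoc, mul_smul_comm,
    smul_smul, smul_add, smul_sub, h.mon_mul hs hd, hq]
  refine ⟨?_, ?_, ?_, ?_, ?_, ?_, ?_, ?_, ?_⟩ <;> norm_num <;> match_scalars <;> field_simp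

/-- Unlike the commutations with monomials, these do not hold term by term: individual products pick
up different powers of `q`, and only the sums over equal monomials agree. -/
theorem IsWeyl.qComm_lam (h : IsWeyl q u w) (hs : s ^ 2 = q) (hd : Distinct i j k)
    (κ : Fin n → ℂˣ) :
    QComm q 0 (w j * lam3 s κ u w i j k) (u j * lam1 s κ u w i j k) ∧
    QComm q 0 (w j * lam3 s κ u w i j k) (u i * lam2 s κ u w i j k) ∧
    QComm q 1 (u i * lam2 s κ u w i j k) (u j * lam1 s κ u w i j k) := by
  obtain ⟨e1, e2, e3, e4, e5, e6, e7, e8, e9, e10, e11, e12⟩ :=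
    h.mon_eqs (i := i) (j := j) (k := k)
  obtain ⟨l1, l2, l3⟩ := h.lam_eqs hs hd κ
  have hq : (q : ℂ) = (s : ℂ) ^ 2 := by rw [← hs]; simp
  rw [l1, l2, l3, e1, e2, e5]
  simp only [QComm, zpow_one, zpow_zero, Units.val_one, mul_add, add_mul, mul_sub,
    sub_mul, smul_mul_assoc, mul_smul_comm, smul_smul, smul_add, smul_sub, h.mon_mul hs hd, hq]
  norm_num
  refine ⟨?_, ?_, ?_⟩ <;> match_scalars <;> field_simp <;> ring

/-- The identity behind the formula for `u i` in terms of its image. -/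
theorem IsWeyl.lam_identity_u (h : IsWeyl q u w) (hs : s ^ 2 = q) (hd : Distinct i j k)
    (κ : Fin n → ℂˣ) :
    (s : ℂ) • (u i * (w j * lam3 s κ u w i j k) * (u j * lam1 s κ u w i j k)) =
      (s : ℂ) • (u i * (w k)⁻¹ * (w j * w i) * (u j * lam1 s κ u w i j k)) +
      (s : ℂ) • ((u j * u k) * (w j * lam3 s κ u w i j k)) -
      (κ j : ℂ) • (u i * lam2 s κ u w i j k * ((u j * u k) * (w j * w i))) := by
  obtain ⟨e1, e2, e3, e4, e5, e6, e7, e8, e9, e10, e11, e12⟩ :=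
    h.mon_eqs (i := i) (j := j) (k := k)
  obtain ⟨l1, l2, l3⟩ := h.lam_eqs hs hd κ
  rw [l1, l2, l3, e12, e1, e2, e3, e4, e5]
  simp only [mul_add, add_mul, mul_sub, sub_mul, smul_mul_assoc, mul_smul_comm, smul_smul,
    smul_add, smul_sub, h.mon_mul hs hd]
  norm_num
  match_scalars <;> field_simp
  ring

/-- The identity behind the formula for `(w i)⁻¹` in terms of its image. -/
theorem IsWeyl.lam_identity_w (h : IsWeyl q u w) (hs : s ^ 2 = q) (hd : Distinct i j k)
    (κ : Fin n → ℂˣ) :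
    (w i)⁻¹ * (u i * lam2 s κ u w i j k * (u j * lam1 s κ u w i j k)) =
      ((κ k : ℂ) / κ j) • ((w i)⁻¹ * (w j)⁻¹ * (u j * lam1 s κ u w i j k)) -
      ((s : ℂ) * κ i / κ j) • ((w i)⁻¹ * (w j)⁻¹ * (w j * lam3 s κ u w i j k)) +
      ((κ i : ℂ) * s ^ 2) • (u i * lam2 s κ u w i j k) := by
  obtain ⟨e1, e2, e3, e4, e5, e6, e7, e8, e9, e10, e11, e12⟩ :=
    h.mon_eqs (i := i) (j := j) (k := k)
  obtain ⟨l1, l2, l3⟩ := h.lam_eqs hs hd κ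
  rw [l1, l2, l3, e10, e11, e1, e2, e5]
  simp only [mul_add, add_mul, mul_sub, sub_mul, smul_mul_assoc, mul_smul_comm, smul_smul,
    smul_add, smul_sub, h.mon_mul hs hd]
  norm_num
  match_scalars <;> field_simp
  ring

/-- The identity behind the formula for `(u k)⁻¹` in terms of its image. -/
theorem IsWeyl.lam_identity_u' (h : IsWeyl q u w) (hs : s ^ 2 = q) (hd : Distinct i j k)
    (κ : Fin n → ℂˣ) :
    (u k)⁻¹ * (w k * (u i)⁻¹ * (u i * lam2 s κ u w i j k * (w j * lam3 s κ u w i j k))) =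
      ((κ i : ℂ) / κ j) • ((u k)⁻¹ * (u j)⁻¹ * (w j * lam3 s κ u w i j k)) -
      ((κ k : ℂ) / (s * κ j)) • ((u k)⁻¹ * (u j)⁻¹ * (u j * lam1 s κ u w i j k)) +
      ((κ k : ℂ) / s ^ 2) • (u i * lam2 s κ u w i j k * (w k * (u i)⁻¹)) := by
  obtain ⟨e1, e2, e3, e4, e5, e6, e7, e8, e9, e10, e11, e12⟩ :=
    h.mon_eqs (i := i) (j := j) (k := k)
  obtain ⟨l1, l2, l3⟩ := h.lam_eqs hs hd κ
  rw [l1, l2, l3, e7, e8, e9, e1, e2, e5, e6]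
  simp only [mul_add, add_mul, mul_sub, sub_mul, smul_mul_assoc, mul_smul_comm, smul_smul,
    smul_add, smul_sub, h.mon_mul hs hd]
  norm_num
  match_scalars <;> field_simp
  ring

/-- The images of the `u l` under the mapping `R i j k`. -/
noncomputable def flipU (s : ℂˣ) (κ : Fin n → ℂˣ) (i j k : Fin n) (u w : Fin n → D) (l : Fin n) :
    D :=
  if l = i then (lam2 s κ u w i j k)⁻¹ * (w k)⁻¹
  else if l = j then (lam1 s κ u w i j k)⁻¹ * u k
  else if l = k then u j * lam1 s κ u w i j k
  else u l

/-- The images of the `w l` under the mapping `R i j k`. -/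
noncomputable def flipW (s : ℂˣ) (κ : Fin n → ℂˣ) (i j k : Fin n) (u w : Fin n → D) (l : Fin n) :
    D :=
  if l = i then w j * lam3 s κ u w i j k
  else if l = j then (lam3 s κ u w i j k)⁻¹ * w i
  else if l = k then (lam2 s κ u w i j k)⁻¹ * (u i)⁻¹
  else w l

/-- None of `Λ₁, Λ₂, Λ₃` vanishes. -/
structure LamNeZero (s : ℂˣ) (κ : Fin n → ℂˣ) (u w : Fin n → D) (i j k : Fin n) : Prop where
  lam1_ne_zero : lam1 s κ u w i j k ≠ 0
  lam2_ne_zero : lam2 s κ u w i j k ≠ 0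
  lam3_ne_zero : lam3 s κ u w i j k ≠ 0

theorem flip_eqs (h : IsWeyl q u w) (hd : Distinct i j k) (κ : Fin n → ℂˣ) :
    flipW s κ i j k u w i = w j * lam3 s κ u w i j k ∧
    flipW s κ i j k u w j = (w j * lam3 s κ u w i j k)⁻¹ * (w j * w i) ∧
    flipW s κ i j k u w k = (u i * lam2 s κ u w i j k)⁻¹ ∧
    flipU s κ i j k u w i = (u i * lam2 s κ u w i j k)⁻¹ * (u i * (w k)⁻¹) ∧
    flipU s κ i j k u w j = (u j * lam1 s κ u w i j k)⁻¹ * (u j * u k) ∧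
    flipU s κ i j k u w k = u j * lam1 s κ u w i j k := by
  have h1 := h.u_ne_zero i
  have h2 := h.u_ne_zero j
  have h3 := h.w_ne_zero j
  simp [flipU, flipW, hd.ij.symm, hd.ik.symm, hd.jk.symm, mul_assoc, h1, h2, h3]

theorem flip_of_ne (κ : Fin n → ℂˣ) {l : Fin n} (hi : l ≠ i) (hj : l ≠ j) (hk : l ≠ k) :
    flipU s κ i j k u w l = u l ∧ flipW s κ i j k u w l = w l := by
  simp [flipU, flipW, hi, hj, hk]

theorem lam_commute {y : D} (κ : Fin n → ℂˣ) (hui : Commute (u i) y) (huj : Commute (u j) y)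
    (huk : Commute (u k) y) (hwi : Commute (w i) y) (hwj : Commute (w j) y)
    (hwk : Commute (w k) y) :
    Commute (lam1 s κ u w i j k) y ∧ Commute (lam2 s κ u w i j k) y ∧
      Commute (lam3 s κ u w i j k) y := by
  have hui' := hui.inv_left₀
  have huj' := huj.inv_left₀
  have hwj' := hwj.inv_left₀
  have hwk' := hwk.inv_left₀
  refine ⟨?_, ?_, ?_⟩
  · exact ((hui'.mul_left huk).sub_left ((hui'.mul_left hwi).smul_left _)).add_left
      ((hwi.mul_left huj').smul_left _)
  · exact (((huj'.mul_left hwk').smul_left _).add_left ((hui'.mul_left hwj').smul_left _)).sub_left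
      ((huj'.mul_left hwj').smul_left _)
  · exact ((hwi.mul_left hwk').sub_left ((huk.mul_left hwk').smul_left _)).add_left
      ((hwj'.mul_left huk).smul_left _)

theorem flip_commute {y : D} (κ : Fin n → ℂˣ) (hui : Commute (u i) y) (huj : Commute (u j) y)
    (huk : Commute (u k) y) (hwi : Commute (w i) y) (hwj : Commute (w j) y)
    (hwk : Commute (w k) y) (l : Fin n) (hl : l = i ∨ l = j ∨ l = k) :
    Commute (flipU s κ i j k u w l) y ∧ Commute (flipW s κ i j k u w l) y := by
  obtain ⟨h1, h2, h3⟩ := lam_commute (s := s) κ hui huj huk hwi hwj hwk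
  unfold flipU flipW
  split_ifs with c1 c2 c3
  · exact ⟨h2.inv_left₀.mul_left hwk.inv_left₀, hwj.mul_left h3⟩
  · exact ⟨h1.inv_left₀.mul_left huk, h3.inv_left₀.mul_left hwi⟩
  · exact ⟨huj.mul_left h1, h2.inv_left₀.mul_left hui.inv_left₀⟩
  · tauto

theorem IsWeyl.flip (h : IsWeyl q u w) (hs : s ^ 2 = q) (hd : Distinct i j k) (κ : Fin n → ℂˣ)
    (hne : LamNeZero s κ u w i j k) :
    IsWeyl q (flipU s κ i j k u w) (flipW s κ i j k u w) := by
  obtain ⟨f1, f2, f3, f4, f5, f6⟩ := flip_eqs (s := s) h hd κ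
  obtain ⟨m12, m13, m23⟩ := h.qComm_monomials hs hd
  obtain ⟨a1, a2, a3, b1, b2, b3, c1, c2, c3⟩ := h.qComm_lam_monomials hs hd κ
  obtain ⟨ab, ac, cb⟩ := h.qComm_lam hs hd κ
  have ha : w j * lam3 s κ u w i j k ≠ 0 := mul_ne_zero (h.w_ne_zero j) hne.lam3_ne_zero
  have hb : u j * lam1 s κ u w i j k ≠ 0 := mul_ne_zero (h.u_ne_zero j) hne.lam1_ne_zero
  have hc : u i * lam2 s κ u w i j k ≠ 0 := mul_ne_zero (h.u_ne_zero i) hne.lam2_ne_zero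
  have hM1 : w j * w i ≠ 0 := mul_ne_zero (h.w_ne_zero j) (h.w_ne_zero i)
  have hM2 : u j * u k ≠ 0 := mul_ne_zero (h.u_ne_zero j) (h.u_ne_zero k)
  have hM3 : u i * (w k)⁻¹ ≠ 0 := mul_ne_zero (h.u_ne_zero i) (inv_ne_zero (h.w_ne_zero k))
  have hcomm : ∀ l l', (l = i ∨ l = j ∨ l = k) → l' ≠ i → l' ≠ j → l' ≠ k →
      (Commute (flipU s κ i j k u w l) (u l') ∧ Commute (flipW s κ i j k u w l) (u l')) ∧
      Commute (flipU s κ i j k u w l) (w l') ∧ Commute (flipW s κ i j k u w l) (w l') := by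
    intro l l' hl hi hj hk
    refine ⟨flip_commute κ (h.u_mul_u _ _) (h.u_mul_u _ _) (h.u_mul_u _ _) ?_ ?_ ?_ l hl,
      flip_commute κ ?_ ?_ ?_ (h.w_mul_w _ _) (h.w_mul_w _ _) (h.w_mul_w _ _) l hl⟩
    exacts [(h.u_mul_w_of_ne _ _ hi).symm, (h.u_mul_w_of_ne _ _ hj).symm,
      (h.u_mul_w_of_ne _ _ hk).symm, h.u_mul_w_of_ne _ _ hi.symm, h.u_mul_w_of_ne _ _ hj.symm,
      h.u_mul_w_of_ne _ _ hk.symm]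
  -- From here on only the table of exponents matters: each relation between images is an addition
  -- of exponents.
  generalize w j * lam3 s κ u w i j k = a at *
  generalize u j * lam1 s κ u w i j k = b at *
  generalize u i * lam2 s κ u w i j k = c at *
  generalize w j * w i = M₁ at *
  generalize u j * u k = M₂ at *
  generalize u i * (w k)⁻¹ = M₃ at *
  have W12 : QComm q 0 a (a⁻¹ * M₁) :=
    ((qComm_zero.2 rfl : QComm q 0 a a).inv_right.mul_right a1).cast (by norm_num)
  have W13 : QComm q 0 a c⁻¹ := ac.inv_right.cast (by norm_num)
  have W23 : QComm q 0 (a⁻¹ * M₁) c⁻¹ :=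
    (ac.inv_left.mul_left c1.symm).inv_right.cast (by norm_num)
  have U12 : QComm q 0 (c⁻¹ * M₃) (b⁻¹ * M₂) :=
    ((cb.inv_left.mul_left b3.symm).inv_right.mul_right (c2.inv_left.mul_left m23.symm)).cast
      (by norm_num)
  have U13 : QComm q 0 (c⁻¹ * M₃) b := (cb.inv_left.mul_left b3.symm).cast (by norm_num)
  have U23 : QComm q 0 (b⁻¹ * M₂) b :=
    ((qComm_zero.2 rfl : QComm q 0 b b).inv_left.mul_left b2.symm).cast (by norm_num)
  have X11 : QComm q 1 (c⁻¹ * M₃) a := (ac.symm.inv_left.mul_left a3.symm).cast (by norm_num)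
  have X12 : QComm q 0 (c⁻¹ * M₃) (a⁻¹ * M₁) :=
    (X11.inv_right.mul_right (c1.inv_left.mul_left m13.symm)).cast (by norm_num)
  have X13 : QComm q 0 (c⁻¹ * M₃) c⁻¹ :=
    ((qComm_zero.2 rfl : QComm q 0 c c).inv_left.mul_left c3.symm).inv_right.cast (by norm_num)
  have X21 : QComm q 0 (b⁻¹ * M₂) a := (ab.symm.inv_left.mul_left a2.symm).cast (by norm_num)
  have X22 : QComm q 1 (b⁻¹ * M₂) (a⁻¹ * M₁) :=
    (X21.inv_right.mul_right (b1.inv_left.mul_left m12.symm)).cast (by norm_num)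
  have X23 : QComm q 0 (b⁻¹ * M₂) c⁻¹ :=
    (cb.symm.inv_left.mul_left c2.symm).inv_right.cast (by norm_num)
  have X31 : QComm q 0 b a := ab.symm.cast (by norm_num)
  have X32 : QComm q 0 b (a⁻¹ * M₁) := (X31.inv_right.mul_right b1).cast (by norm_num)
  have X33 : QComm q 1 b c⁻¹ := cb.symm.inv_right.cast (by norm_num)
  have cases3 : ∀ l : Fin n, (l = i ∨ l = j ∨ l = k) ∨ (l ≠ i ∧ l ≠ j ∧ l ≠ k) := by
    intro l; tauto
  rw [qComm_zero] at W12 W13 W23 U12 U13 U23 X12 X13 X21 X23 X31 X32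
  rw [qComm_one] at X11 X22 X33
  refine ⟨fun l => ?_, fun l => ?_, fun l m => ?_, fun l m => ?_, fun l => ?_, fun l m hlm => ?_⟩
  · rcases cases3 l with (rfl | rfl | rfl) | ⟨hi, hj, hk⟩
    · rw [f4]; exact mul_ne_zero (inv_ne_zero hc) hM3
    · rw [f5]; exact mul_ne_zero (inv_ne_zero hb) hM2
    · rw [f6]; exact hb
    · rw [(flip_of_ne κ hi hj hk).1]; exact h.u_ne_zero l
  · rcases cases3 l with (rfl | rfl | rfl) | ⟨hi, hj, hk⟩
    · rw [f1]; exact ha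
    · rw [f2]; exact mul_ne_zero (inv_ne_zero ha) hM1
    · rw [f3]; exact inv_ne_zero hc
    · rw [(flip_of_ne κ hi hj hk).2]; exact h.w_ne_zero l
  · rcases cases3 l with hl | ⟨hi, hj, hk⟩ <;> rcases cases3 m with hm | ⟨hi', hj', hk'⟩
    · rcases hl with rfl | rfl | rfl <;> rcases hm with rfl | rfl | rfl <;>
        simp only [f4, f5, f6, U12, U13, U23]
    · rw [(flip_of_ne (u := u) κ hi' hj' hk').1]; exact (hcomm l m hl hi' hj' hk').1.1
    · rw [(flip_of_ne (u := u) κ hi hj hk).1]; exact (hcomm m l hm hi hj hk).1.1.symm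
    · rw [(flip_of_ne (u := u) κ hi hj hk).1, (flip_of_ne (u := u) κ hi' hj' hk').1]
      exact h.u_mul_u l m
  · rcases cases3 l with hl | ⟨hi, hj, hk⟩ <;> rcases cases3 m with hm | ⟨hi', hj', hk'⟩
    · rcases hl with rfl | rfl | rfl <;> rcases hm with rfl | rfl | rfl <;>
        simp only [f1, f2, f3, W12, W13, W23]
    · rw [(flip_of_ne (w := w) κ hi' hj' hk').2]; exact (hcomm l m hl hi' hj' hk').2.2
    · rw [(flip_of_ne (w := w) κ hi hj hk).2]; exact (hcomm m l hm hi hj hk).2.2.symm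
    · rw [(flip_of_ne (w := w) κ hi hj hk).2, (flip_of_ne (w := w) κ hi' hj' hk').2]
      exact h.w_mul_w l m
  · rcases cases3 l with (rfl | rfl | rfl) | ⟨hi, hj, hk⟩
    · rw [f4, f1, X11]
    · rw [f5, f2, X22]
    · rw [f6, f3, X33]
    · rw [(flip_of_ne κ hi hj hk).1, (flip_of_ne κ hi hj hk).2]; exact h.u_mul_w_self l
  · rcases cases3 l with hl | ⟨hi, hj, hk⟩ <;> rcases cases3 m with hm | ⟨hi', hj', hk'⟩
    · rcases hl with rfl | rfl | rfl <;> rcases hm with rfl | rfl | rfl <;>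
        first
          | exact absurd rfl hlm
          | simp only [f1, f2, f3, f4, f5, f6, X12, X13, X21, X23, X31, X32]
    · rw [(flip_of_ne (w := w) κ hi' hj' hk').2]; exact (hcomm l m hl hi' hj' hk').2.1
    · rw [(flip_of_ne (u := u) κ hi hj hk).1]; exact (hcomm m l hm hi hj hk).1.2.symm
    · rw [(flip_of_ne (u := u) κ hi hj hk).1, (flip_of_ne (w := w) κ hi' hj' hk').2]
      exact h.u_mul_w_of_ne l m hlm

end flip

/-! ### Injectivity by growth of dimension -/

section growth

variable {q : ℂˣ} {n : ℕ} {D : Type*} [DivisionRing D] [Algebra ℂ D]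

namespace WeylAlg

theorem boxSpan_mono {a b : ℕ} (hab : a ≤ b) : boxSpan q n a ≤ boxSpan q n b := by
  intro x hx
  rw [mem_boxSpan] at hx ⊢
  refine hx.trans fun e he => ?_
  have hab' : (a : ℤ) ≤ b := by exact_mod_cast hab
  rw [mem_box] at he ⊢
  exact ⟨fun i => (he.1 i).trans hab', fun i => (he.2 i).trans hab'⟩

theorem exists_mem_boxSpan (x : WeylAlg q n) : ∃ m, x ∈ boxSpan q n m := by
  obtain ⟨m, hm⟩ := exists_support_subset_box x
  exact ⟨m, mem_boxSpan.2 hm⟩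

theorem map_mul_mem_boxSpan (f : WeylAlg q n →ₐ[ℂ] D) {a b : ℕ} {x y : D}
    (hx : x ∈ (boxSpan q n a).map f.toLinearMap) (hy : y ∈ (boxSpan q n b).map f.toLinearMap) :
    x * y ∈ (boxSpan q n (a + b)).map f.toLinearMap := by
  obtain ⟨x, hx, rfl⟩ := hx
  obtain ⟨y, hy, rfl⟩ := hy
  exact ⟨x * y, mul_mem_boxSpan hx (mem_boxSpan.1 hy), map_mul f x y⟩

theorem one_mem_boxSpan (a : ℕ) : (1 : WeylAlg q n) ∈ boxSpan q n a := by
  rw [mem_boxSpan, one_def, coeff_mono]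
  refine Finsupp.support_single_subset.trans (Finset.singleton_subset_iff.2 ?_)
  rw [mem_box]
  simp

theorem mono_add_fst (a b : Fin n → ℤ) :
    mono q (a + b, (0 : Fin n → ℤ)) 1 = mono q (a, 0) 1 * mono q (b, 0) 1 := by
  simp [mono_mul_mono, twist]

theorem mono_add_snd (a b : Fin n → ℤ) :
    mono q ((0 : Fin n → ℤ), a + b) 1 = mono q (0, a) 1 * mono q (0, b) 1 := by
  simp [mono_mul_mono, twist]

theorem mono_eq_mul (a b : Fin n → ℤ) :
    mono q (a, b) 1 = mono q (a, 0) 1 * mono q (0, b) 1 := by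
  simp [mono_mul_mono, twist]

/-- If `p` is a nonzero element of the kernel of `f`, the image of a box has smaller dimension. -/
theorem finrank_map_boxSpan_add_le (f : WeylAlg q n →ₐ[ℂ] D) {p : WeylAlg q n} (hp : p ≠ 0)
    (hfp : f p = 0) {m : ℕ} (hm : p ∈ boxSpan q n m) (M : ℕ) :
    Module.finrank ℂ ((boxSpan q n (M + m)).map f.toLinearMap) + (2 * M + 1) ^ (n + n) ≤
      (2 * (M + m) + 1) ^ (n + n) := by
  set L : boxSpan q n (M + m) →ₗ[ℂ] D := f.toLinearMap.comp (boxSpan q n (M + m)).subtype with hL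
  have hrange : LinearMap.range L = (boxSpan q n (M + m)).map f.toLinearMap := by
    rw [hL, LinearMap.range_comp, Submodule.range_subtype]
  have hrank := LinearMap.finrank_range_add_finrank_ker L
  rw [finrank_boxSpan, hrange] at hrank
  rw [← hrank]
  gcongr
  -- The kernel contains `x * p` for every `x` in the box of size `M`, and `x ↦ x * p` is injective
  -- in a domain.
  let K : boxSpan q n M →ₗ[ℂ] LinearMap.ker L :=
    { toFun := fun x => ⟨⟨x.1 * p, mul_mem_boxSpan x.2 (mem_boxSpan.1 hm)⟩, by
        rw [LinearMap.mem_ker]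
        change f (x.1 * p) = 0
        rw [map_mul, hfp, mul_zero]⟩
      map_add' := fun x y => by
        ext1; ext1
        simp [add_mul]
      map_smul' := fun c x => by
        ext1; ext1
        simp }
  have hK : Function.Injective K := by
    rw [← LinearMap.ker_eq_bot, LinearMap.ker_eq_bot']
    intro x hx
    have : x.1 * p = 0 := congrArg (fun z => z.1.1) hx
    exact Subtype.ext ((mul_eq_zero.1 this).resolve_right hp)
  have := LinearMap.finrank_le_finrank_of_injective hK
  rwa [finrank_boxSpan] at this

end WeylAlg

/-- With `M = c * N - m`, the two powers of size about `(2 * c * N) ^ d` differ only by order `N ^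
(d - 1)`, which `(N + 1) ^ d` exceeds for large `N`. -/
theorem exists_growth_lt (c d m : ℕ) (hc : 0 < c) : ∃ N M : ℕ, c * N = M + m ∧
    (2 * (M + m) + 1) ^ d < (N + 1) ^ d + (2 * M + 1) ^ d := by
  -- Bernoulli's inequality loses `d * (2 * m / X)` with `X > N`, and the other summand gains at
  -- least `(1 / (2 * c + 1)) ^ d`; the first term of the bound makes the gain larger. The summand
  -- `m` ensures `m ≤ c * N`.
  obtain ⟨N, hN⟩ := exists_nat_gt ((2 * d * m : ℝ) * (2 * c + 1) ^ d + m)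
  have hN0 : (m : ℝ) < N := lt_of_le_of_lt (by simp; positivity) hN
  have hmN : m ≤ c * N := by
    have : m < N := by exact_mod_cast hN0
    nlinarith
  refine ⟨N, c * N - m, by omega, ?_⟩
  set M := c * N - m
  have hM : (M : ℝ) = c * N - m := by
    have : M + m = c * N := by omega
    have : (M : ℝ) + m = c * N := by exact_mod_cast this
    linarith
  have hc1 : (1 : ℝ) ≤ c := by exact_mod_cast hc
  have hm0 : (0 : ℝ) ≤ m := Nat.cast_nonneg _
  have hNpos : (0 : ℝ) < N := by linarith
  set X : ℝ := 2 * (M + m) + 1 with hX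
  have hXN : (N : ℝ) < X := by rw [hX, hM]; nlinarith
  have hXpos : 0 < X := by linarith
  have h1 : 1 - d * (2 * m / X) ≤ ((2 * M + 1) / X) ^ d := by
    have h2 := one_add_mul_le_pow (a := -(2 * m / X)) (by
      have : 2 * m / X ≤ 2 := by
        rw [div_le_iff₀ hXpos]
        linarith
      linarith) d
    have h3 : 1 + -(2 * m / X) = (2 * M + 1) / X := by
      rw [hX]; field_simp; ring
    rw [h3] at h2
    linarith
  have h4 : (1 / (2 * c + 1) : ℝ) ^ d ≤ ((N + 1) / X) ^ d := by
    refine pow_le_pow_left₀ (by positivity) ?_ d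
    rw [div_le_div_iff₀ (by positivity) hXpos, hX, hM]
    nlinarith
  have h5 : d * (2 * m / X) < (1 / (2 * c + 1) : ℝ) ^ d := by
    rw [one_div, inv_pow, ← one_div, lt_div_iff₀ (by positivity), ← mul_div_assoc, div_mul_eq_mul_div,
      div_lt_iff₀ hXpos]
    nlinarith
  have h6 : (1 : ℝ) < ((N + 1) / X) ^ d + ((2 * M + 1) / X) ^ d := by linarith
  rw [div_pow, div_pow, ← add_div, lt_div_iff₀ (by positivity), one_mul] at h6
  rw [hX] at h6
  exact_mod_cast h6

/-- Each step in the direction `σ i` costs at most `r`. Only nonnegative multiples of `σ i` are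
taken, because the inverse of a generator need not be known to lie in the filtration. -/
theorem zpow_mem_filtration (V : ℕ → Submodule ℂ D) (hone : ∀ a, (1 : D) ∈ V a)
    (hmul : ∀ {a b x y}, x ∈ V a → y ∈ V b → x * y ∈ V (a + b)) (g : (Fin n → ℤ) → D)
    (g_zero : g 0 = 1) (g_add : ∀ a b, g (a + b) = g a * g b) (σ : Fin n → ℤ) {r : ℕ}
    (hg : ∀ i, g (Pi.single i (σ i)) ∈ V r) (x : Fin n → ℕ) :
    g (fun i => σ i * x i) ∈ V (r * ∑ i, x i) := by
  induction x using Pi.single_induction with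
  | zero =>
    have : (fun i => σ i * ((0 : Fin n → ℕ) i : ℤ)) = 0 := by ext; simp
    rw [this, g_zero]
    exact hone _
  | add x y hx hy =>
    have h1 : (fun i => σ i * (((x + y) i : ℕ) : ℤ)) =
        (fun i => σ i * (x i : ℤ)) + fun i => σ i * (y i : ℤ) := by
      ext i; simp [mul_add]
    rw [h1, g_add]
    simp only [Pi.add_apply, Finset.sum_add_distrib, mul_add]
    exact hmul hx hy
  | single i k =>
    have h1 : (fun j => σ j * ((Pi.single i k : Fin n → ℕ) j : ℤ)) = Pi.single i (σ i * k) := by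
      ext j
      by_cases hj : j = i
      · subst hj; simp
      · simp [hj]
    rw [h1]
    simp only [Finset.sum_pi_single', Finset.mem_univ, if_true]
    clear h1
    induction k with
    | zero =>
      have : (Pi.single i (σ i * ((0 : ℕ) : ℤ)) : Fin n → ℤ) = 0 := by simp
      rw [this, g_zero]
      exact hone _
    | succ k ih =>
      have : (Pi.single i (σ i * ((k + 1 : ℕ) : ℤ)) : Fin n → ℤ) =
          Pi.single i (σ i * (k : ℤ)) + Pi.single i (σ i) := by
        rw [← Pi.single_add]; push_cast; ring_nf
      rw [this, g_add, mul_add, mul_one]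
      exact hmul ih (hg i)

/-- A homomorphism from the Weyl algebra to its skew field of fractions is injective if its range
contains a nontrivial power of every generator. -/
theorem WeylAlg.injective_of_mono_mem_range (f : WeylAlg q n →ₐ[ℂ] WeylFrac q n) (σ τ : Fin n → ℤ)
    (hσ : ∀ i, σ i ≠ 0) (hτ : ∀ i, τ i ≠ 0)
    (hu : ∀ i, WeylFrac.ofAlg q n (mono q (Pi.single i (σ i), 0) 1) ∈ f.range)
    (hw : ∀ i, WeylFrac.ofAlg q n (mono q (0, Pi.single i (τ i)) 1) ∈ f.range) :
    Function.Injective f := by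
  rw [injective_iff_map_eq_zero]
  intro p hfp
  by_contra hp
  set V : ℕ → Submodule ℂ (WeylFrac q n) := fun N => (boxSpan q n N).map f.toLinearMap with hV
  have hVmono : ∀ {a b : ℕ}, a ≤ b → V a ≤ V b := fun hab => Submodule.map_mono (boxSpan_mono hab)
  have hone : ∀ a, (1 : WeylFrac q n) ∈ V a := fun a => ⟨1, one_mem_boxSpan a, map_one f⟩
  obtain ⟨m, hm⟩ := exists_mem_boxSpan p
  have hV1 : ∀ x ∈ f.range, ∃ a, x ∈ V a := by
    rintro _ ⟨x, rfl⟩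
    obtain ⟨a, ha⟩ := exists_mem_boxSpan x
    exact ⟨a, x, ha, rfl⟩
  choose a ha using fun i => hV1 _ (hu i)
  choose b hb using fun i => hV1 _ (hw i)
  set r := ∑ i, (a i + b i) with hr
  have har : ∀ i, a i ≤ r := fun i =>
    (Nat.le_add_right _ _).trans (Finset.single_le_sum (f := fun i => a i + b i)
      (fun _ _ => Nat.zero_le _) (Finset.mem_univ i))
  have hbr : ∀ i, b i ≤ r := fun i =>
    (Nat.le_add_left _ _).trans (Finset.single_le_sum (f := fun i => a i + b i)
      (fun _ _ => Nat.zero_le _) (Finset.mem_univ i))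
  have key₁ := zpow_mem_filtration V hone (fun hx hy => map_mul_mem_boxSpan f hx hy)
    (fun e => WeylFrac.ofAlg q n (mono q (e, 0) 1)) (map_one _)
    (fun e e' => by rw [mono_add_fst, map_mul]) σ fun i => hVmono (har i) (ha i)
  have key₂ := zpow_mem_filtration V hone (fun hx hy => map_mul_mem_boxSpan f hx hy)
    (fun e => WeylFrac.ofAlg q n (mono q (0, e) 1)) (map_one _)
    (fun e e' => by rw [mono_add_snd, map_mul]) τ fun i => hVmono (hbr i) (hb i)
  -- Exponent vectors with entries at most `N` have sum at most `n * N`, and both the `u` part and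
  -- the `w` part cost `r` per unit. The `+ 1` keeps `c` positive.
  set c := r * n + r * n + 1 with hc
  obtain ⟨N, M, hNM, hlt⟩ := exists_growth_lt c (n + n) m (Nat.succ_pos _)
  have hle := finrank_map_boxSpan_add_le f hp hfp hm M
  let F : (Fin n → Fin (N + 1)) × (Fin n → Fin (N + 1)) → WeylExp n := fun x =>
    (fun i => σ i * ((x.1 i : ℕ) : ℤ), fun i => τ i * ((x.2 i : ℕ) : ℤ))
  have hF : Function.Injective F := by
    rintro ⟨x, y⟩ ⟨x', y'⟩ h
    have h1 := congrArg Prod.fst h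
    have h2 := congrArg Prod.snd h
    ext i
    · have := mul_left_cancel₀ (hσ i) (congrFun h1 i)
      exact_mod_cast this
    · have := mul_left_cancel₀ (hτ i) (congrFun h2 i)
      exact_mod_cast this
  have hmem : ∀ x, WeylFrac.ofAlg q n (mono q (F x) 1) ∈ V (M + m) := by
    rintro ⟨x, y⟩
    have h1 : ∀ x : Fin n → Fin (N + 1), ∑ i, ((x i : ℕ)) ≤ n * N := fun x =>
      (Finset.sum_le_sum fun i _ => Nat.lt_succ_iff.1 (x i).2).trans (by simp)
    have h2 := map_mul_mem_boxSpan f (key₁ fun i => x i) (key₂ fun i => y i)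
    rw [← map_mul, ← mono_eq_mul] at h2
    refine hVmono ?_ h2
    have h3 := Nat.mul_le_mul_left r (h1 x)
    have h4 := Nat.mul_le_mul_left r (h1 y)
    rw [← hNM, hc]
    nlinarith
  -- This puts `(N + 1) ^ (n + n)` independent monomials into `V (M + m)`, more than `hle` and `hlt`
  -- together allow.
  have hli : LinearIndependent ℂ fun x => (⟨_, hmem x⟩ : V (M + m)) := by
    have h0 : LinearIndependent ℂ fun e : WeylExp n => (Finsupp.single e 1 : WeylExp n →₀ ℂ) :=
      Finsupp.linearIndependent_single_one ℂ (WeylExp n)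
    have h1 : LinearIndependent ℂ fun e : WeylExp n => WeylFrac.ofAlg q n (mono q e 1) :=
      (h0.map' (coeff (q := q)).symm.toLinearMap (LinearEquiv.ker _)).map'
        (WeylFrac.ofAlg q n).toLinearMap (LinearMap.ker_eq_bot.2 WeylFrac.ofAlg_injective)
    exact LinearIndependent.of_comp (V (M + m)).subtype (h1.comp F hF)
  have hcard := hli.fintype_card_le_finrank
  have : Fintype.card ((Fin n → Fin (N + 1)) × (Fin n → Fin (N + 1))) = (N + 1) ^ (n + n) := by
    simp [pow_add]
  rw [this] at hcard
  have : Module.finrank ℂ (V (M + m)) =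
    Module.finrank ℂ ((boxSpan q n (M + m)).map f.toLinearMap) := rfl
  omega

end growth

/-! ### Existence and uniqueness of the mapping -/

section existence

variable {q s : ℂˣ} {n : ℕ} {D : Type*} [DivisionRing D] [Algebra ℂ D] {i j k : Fin n}

theorem zpowProd_mem {S : Subalgebra ℂ D} (x : Fin n → D) (hx : ∀ i, x i ≠ 0)
    (hc : ∀ i j, x i * x j = x j * x i) (hS : ∀ i, x i ∈ S) (hinv : ∀ i, (x i)⁻¹ ∈ S)
    (a : Fin n → ℤ) : (zpowProd x hx hc (Multiplicative.ofAdd a) : D) ∈ S := by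
  induction a using Pi.single_induction with
  | zero => simp [S.one_mem]
  | add f g hf hg =>
    rw [ofAdd_add, map_mul, Units.val_mul]
    exact S.mul_mem hf hg
  | single i m =>
    rw [zpowProd_single, Units.val_zpow_eq_zpow_val, Units.val_mk0]
    obtain ⟨m, rfl | rfl⟩ := m.eq_nat_or_neg
    · rw [zpow_natCast]
      exact S.pow_mem (hS i) m
    · rw [zpow_neg, zpow_natCast, ← inv_pow]
      exact S.pow_mem (hinv i) m

theorem IsWeyl.lift_mem {u w : Fin n → D} (h : IsWeyl q u w) {S : Subalgebra ℂ D}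
    (hu : ∀ i, u i ∈ S) (hw : ∀ i, w i ∈ S) (hu' : ∀ i, (u i)⁻¹ ∈ S) (hw' : ∀ i, (w i)⁻¹ ∈ S)
    (x : WeylAlg q n) : h.lift x ∈ S := by
  induction x using WeylAlg.induction_on with
  | h0 => rw [map_zero]; exact S.zero_mem
  | hadd x y hx hy => rw [map_add]; exact S.add_mem hx hy
  | hm e a =>
    rw [h.lift_mono]
    exact S.smul_mem (S.mul_mem (zpowProd_mem _ _ _ hu hu' _) (zpowProd_mem _ _ _ hw hw' _)) a

theorem IsWeyl.mem_range_lift {u w : Fin n → D} (h : IsWeyl q u w) (l : Fin n) :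
    (u l ∈ h.lift.range ∧ (u l)⁻¹ ∈ h.lift.range) ∧
      w l ∈ h.lift.range ∧ (w l)⁻¹ ∈ h.lift.range := by
  refine ⟨⟨⟨_, h.lift_u l⟩, WeylAlg.mono q (Pi.single l (-1), 0) 1, ?_⟩, ⟨_, h.lift_w l⟩,
    WeylAlg.mono q (0, Pi.single l (-1)) 1, ?_⟩
  · rw [AlgHom.toRingHom_eq_coe, RingHom.coe_coe, h.lift_mono, one_smul, monoVal, zpowProd_single]
    simp
  · rw [AlgHom.toRingHom_eq_coe, RingHom.coe_coe, h.lift_mono, one_smul, monoVal, zpowProd_single]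
    simp

/-- The Weyl pairs at the vertices are, up to inversion, Laurent polynomials in their images. -/
theorem IsWeyl.mem_range_lift_flip {u w : Fin n → D} (h : IsWeyl q u w) (hs : s ^ 2 = q)
    (hd : Distinct i j k) (κ : Fin n → ℂˣ) (hne : LamNeZero s κ u w i j k) :
    u i ∈ (h.flip hs hd κ hne).lift.range ∧ u j ∈ (h.flip hs hd κ hne).lift.range ∧
    (u k)⁻¹ ∈ (h.flip hs hd κ hne).lift.range ∧ (w i)⁻¹ ∈ (h.flip hs hd κ hne).lift.range ∧
    w j ∈ (h.flip hs hd κ hne).lift.range ∧ w k ∈ (h.flip hs hd κ hne).lift.range := by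
  set H := h.flip hs hd κ hne
  set S := H.lift.range with hS
  obtain ⟨f1, f2, f3, f4, f5, f6⟩ := flip_eqs (s := s) h hd κ
  have ha : w j * lam3 s κ u w i j k ≠ 0 := mul_ne_zero (h.w_ne_zero j) hne.lam3_ne_zero
  have hb : u j * lam1 s κ u w i j k ≠ 0 := mul_ne_zero (h.u_ne_zero j) hne.lam1_ne_zero
  have hc : u i * lam2 s κ u w i j k ≠ 0 := mul_ne_zero (h.u_ne_zero i) hne.lam2_ne_zero
  have hM1 : w j * w i ≠ 0 := mul_ne_zero (h.w_ne_zero j) (h.w_ne_zero i)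
  have hM2 : u j * u k ≠ 0 := mul_ne_zero (h.u_ne_zero j) (h.u_ne_zero k)
  have hM3 : u i * (w k)⁻¹ ≠ 0 := mul_ne_zero (h.u_ne_zero i) (inv_ne_zero (h.w_ne_zero k))
  have e1 := h.lam_identity_u hs hd κ
  have e2 := h.lam_identity_w hs hd κ
  have e3 := h.lam_identity_u' hs hd κ
  have g1 := H.mem_range_lift i
  have g2 := H.mem_range_lift j
  have g3 := H.mem_range_lift k
  rw [f1, f4] at g1
  rw [f2, f5] at g2
  rw [f3, f6] at g3
  have n1 : (w i)⁻¹ * (w j)⁻¹ = (w j * w i)⁻¹ := by rw [mul_inv_rev]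
  have n2 : (u k)⁻¹ * (u j)⁻¹ = (u j * u k)⁻¹ := by rw [mul_inv_rev]
  have n3 : w k * (u i)⁻¹ = (u i * (w k)⁻¹)⁻¹ := by rw [mul_inv_rev, inv_inv]
  have r1 : w j = (w j * w i) * (w i)⁻¹ := by rw [mul_inv_cancel_right₀ (h.w_ne_zero i)]
  have r2 : u j = (u j * u k) * (u k)⁻¹ := by rw [mul_inv_cancel_right₀ (h.u_ne_zero k)]
  have r3 : w k = (u i * (w k)⁻¹)⁻¹ * u i := by
    rw [mul_inv_rev, inv_inv, inv_mul_cancel_right₀ (h.u_ne_zero i)]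
  rw [n1] at e2
  rw [n2, n3] at e3
  generalize w j * lam3 s κ u w i j k = a at *
  generalize u j * lam1 s κ u w i j k = b at *
  generalize u i * lam2 s κ u w i j k = c at *
  generalize w j * w i = M₁ at *
  generalize u j * u k = M₂ at *
  generalize u i * (w k)⁻¹ = M₃ at *
  obtain ⟨⟨-, -⟩, hSa, hSa'⟩ := g1
  obtain ⟨⟨-, -⟩, hS1, hS1'⟩ := g2
  obtain ⟨⟨hSb, hSb'⟩, hSc', hSc⟩ := g3
  rw [inv_inv] at hSc
  -- `a`, `b`, `c` are images or inverses of images, and each `Mᵢ` is a product of two such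
  -- elements. So all six elements and their inverses lie in `S`.
  have hM1S : M₁ ∈ S := by
    have := S.mul_mem hSa hS1
    rwa [mul_inv_cancel_left₀ ha] at this
  have hM1S' : M₁⁻¹ ∈ S := by
    have := S.mul_mem hS1' hSa'
    rwa [mul_inv_rev, inv_inv, mul_inv_cancel_right₀ ha] at this
  have hM2S : M₂ ∈ S := by
    have := S.mul_mem hSb (H.mem_range_lift j).1.1
    rwa [f5, mul_inv_cancel_left₀ hb] at this
  have hM2S' : M₂⁻¹ ∈ S := by
    have := S.mul_mem (H.mem_range_lift j).1.2 hSb'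
    rwa [f5, mul_inv_rev, inv_inv, mul_inv_cancel_right₀ hb] at this
  have hM3S : M₃ ∈ S := by
    have := S.mul_mem hSc (H.mem_range_lift i).1.1
    rwa [f4, mul_inv_cancel_left₀ hc] at this
  have hM3S' : M₃⁻¹ ∈ S := by
    have := S.mul_mem (H.mem_range_lift i).1.2 hSc'
    rwa [f4, mul_inv_rev, inv_inv, mul_inv_cancel_right₀ hc] at this
  -- In `e1` the right side lies in `S` and the left side is `u i` times invertible elements of `S`,
  -- which can be divided out. The identities `e2` and `e3` give `(w i)⁻¹` and `(u k)⁻¹` in the same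
  -- way.
  have hui : u i ∈ S := by
    have h1 : (s : ℂ) • (u i * a * b) ∈ S := by
      rw [e1]
      exact S.sub_mem (S.add_mem (S.smul_mem (S.mul_mem (S.mul_mem hM3S hM1S) hSb) _)
        (S.smul_mem (S.mul_mem hM2S hSa) _)) (S.smul_mem (S.mul_mem hSc (S.mul_mem hM2S hM1S)) _)
    have h2 := S.smul_mem (S.mul_mem (S.mul_mem h1 hSb') hSa') (s : ℂ)⁻¹
    rwa [smul_mul_assoc, smul_mul_assoc, mul_inv_cancel_right₀ hb, mul_inv_cancel_right₀ ha,
      inv_smul_smul₀ s.ne_zero] at h2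
  have hwi : (w i)⁻¹ ∈ S := by
    have h1 : (w i)⁻¹ * (c * b) ∈ S := by
      rw [e2]
      exact S.add_mem (S.sub_mem (S.smul_mem (S.mul_mem hM1S' hSb) _)
        (S.smul_mem (S.mul_mem hM1S' hSa) _)) (S.smul_mem hSc _)
    have h2 := S.mul_mem (S.mul_mem h1 hSb') hSc'
    rwa [← mul_assoc, mul_inv_cancel_right₀ hb, mul_inv_cancel_right₀ hc] at h2
  have huk : (u k)⁻¹ ∈ S := by
    have h1 : (u k)⁻¹ * (M₃⁻¹ * (c * a)) ∈ S := by
      rw [e3]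
      exact S.add_mem (S.sub_mem (S.smul_mem (S.mul_mem hM2S' hSa) _)
        (S.smul_mem (S.mul_mem hM2S' hSb) _)) (S.smul_mem (S.mul_mem hSc hM3S') _)
    have h2 := S.mul_mem (S.mul_mem (S.mul_mem h1 hSa') hSc') hM3S
    rwa [← mul_assoc, ← mul_assoc, mul_inv_cancel_right₀ ha, mul_inv_cancel_right₀ hc,
      inv_mul_cancel_right₀ hM3] at h2
  refine ⟨hui, ?_, huk, hwi, ?_, ?_⟩
  · rw [r2]; exact S.mul_mem hM2S huk
  · rw [r1]; exact S.mul_mem hM1S hwi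
  · rw [r3]; exact S.mul_mem hM3S' hui

namespace WeylFrac

theorem ofAlg_mono (e : WeylExp n) : ofAlg q n (WeylAlg.mono q e 1) = (isWeyl q n).monoVal e := by
  rw [(isWeyl q n).map_mono (ofAlg q n) (fun _ => rfl) (fun _ => rfl), one_smul]

theorem three_terms_ne_zero {e₁ e₂ e₃ : WeylExp n} (h₂ : e₁ ≠ e₂) (h₃ : e₁ ≠ e₃) {a : ℂ}
    (ha : a ≠ 0) (b c : ℂ) :
    a • (isWeyl q n).monoVal e₁ + b • (isWeyl q n).monoVal e₂ + c • (isWeyl q n).monoVal e₃ ≠ 0 := by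
  simp only [← ofAlg_mono, ← map_smul, ← map_add]
  rw [map_ne_zero_iff _ ofAlg_injective]
  intro h
  have := congrArg (fun x => WeylAlg.coeff x e₁) h
  simp [WeylAlg.coeff_mono, h₂.symm, h₃.symm, ha] at this

/-- In each `Λ` the first monomial differs from the other two, so its coefficient cannot cancel. -/
theorem lamNeZero (hs : s ^ 2 = q) (hd : Distinct i j k) (κ : Fin n → ℂˣ) :
    LamNeZero s κ (u q : Fin n → WeylFrac q n) (w q) i j k := by
  obtain ⟨l1, l2, l3⟩ := (isWeyl q n).lam_eqs hs hd κ
  refine ⟨?_, ?_, ?_⟩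
  · rw [l1]
    have := three_terms_ne_zero (q := q) (n := n)
      (e₁ := (Pi.single i (-1) + Pi.single j 0 + Pi.single k 1,
        Pi.single i 0 + Pi.single j 0 + Pi.single k 0))
      (e₂ := (Pi.single i (-1) + Pi.single j 0 + Pi.single k 0,
        Pi.single i 1 + Pi.single j 0 + Pi.single k 0))
      (e₃ := (Pi.single i 0 + Pi.single j (-1) + Pi.single k 0,
        Pi.single i 1 + Pi.single j 0 + Pi.single k 0))
      (fun h => by simpa using congrFun (congrArg Prod.snd h) i)
      (fun h => by simpa using congrFun (congrArg Prod.snd h) i) one_ne_zero (-(s : ℂ)) (κ i)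
    rwa [one_smul, neg_smul, ← sub_eq_add_neg] at this
  · rw [l2]
    have := three_terms_ne_zero (q := q) (n := n)
      (e₁ := (Pi.single i 0 + Pi.single j (-1) + Pi.single k 0,
        Pi.single i 0 + Pi.single j 0 + Pi.single k (-1)))
      (e₂ := (Pi.single i (-1) + Pi.single j 0 + Pi.single k 0,
        Pi.single i 0 + Pi.single j (-1) + Pi.single k 0))
      (e₃ := (Pi.single i 0 + Pi.single j (-1) + Pi.single k 0,
        Pi.single i 0 + Pi.single j (-1) + Pi.single k 0))
      (fun h => by simpa [hd.jk.symm] using congrFun (congrArg Prod.snd h) k)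
      (fun h => by simpa [hd.jk.symm] using congrFun (congrArg Prod.snd h) k)
      (div_ne_zero (κ i).ne_zero (κ j).ne_zero) ((κ k : ℂ) / κ j) (-((κ i : ℂ) * κ k / (s * κ j)))
    rwa [neg_smul, ← sub_eq_add_neg] at this
  · rw [l3]
    have := three_terms_ne_zero (q := q) (n := n)
      (e₁ := (Pi.single i 0 + Pi.single j 0 + Pi.single k 0,
        Pi.single i 1 + Pi.single j 0 + Pi.single k (-1)))
      (e₂ := (Pi.single i 0 + Pi.single j 0 + Pi.single k 1,
        Pi.single i 0 + Pi.single j 0 + Pi.single k (-1)))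
      (e₃ := (Pi.single i 0 + Pi.single j 0 + Pi.single k 1,
        Pi.single i 0 + Pi.single j (-1) + Pi.single k 0))
      (fun h => by simpa [hd.ik, hd.ij] using congrFun (congrArg Prod.snd h) i)
      (fun h => by simpa [hd.ik, hd.ij] using congrFun (congrArg Prod.snd h) i)
      one_ne_zero (-(s : ℂ)) (κ k)
    rwa [one_smul, neg_smul, ← sub_eq_add_neg] at this

theorem isR_iff (hd : Distinct i j k) (κ : Fin n → ℂˣ)
    (R : WeylFrac q n ≃ₐ[ℂ] WeylFrac q n) :
    IsR q s κ i j k R ↔ (∀ l, R (u q l) = flipU s κ i j k (u q) (w q) l) ∧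
      ∀ l, R (w q l) = flipW s κ i j k (u q) (w q) l := by
  constructor
  · intro h
    refine ⟨fun l => ?_, fun l => ?_⟩
    · unfold flipU
      split_ifs with c1 c2 c3
      · rw [c1]; exact h.map_u₁
      · rw [c2]; exact h.map_u₂
      · rw [c3]; exact h.map_u₃
      · exact h.map_u_of_ne l c1 c2 c3
    · unfold flipW
      split_ifs with c1 c2 c3
      · rw [c1]; exact h.map_w₁
      · rw [c2]; exact h.map_w₂
      · rw [c3]; exact h.map_w₃
      · exact h.map_w_of_ne l c1 c2 c3
  · rintro ⟨hu, hw⟩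
    refine ⟨?_, ?_, ?_, ?_, ?_, ?_, fun l hi hj hk => ?_, fun l hi hj hk => ?_⟩
    · rw [hw, flipW, if_pos rfl]; rfl
    · rw [hw, flipW, if_neg hd.ij.symm, if_pos rfl]; rfl
    · rw [hw, flipW, if_neg hd.ik.symm, if_neg hd.jk.symm, if_pos rfl]; rfl
    · rw [hu, flipU, if_pos rfl]; rfl
    · rw [hu, flipU, if_neg hd.ij.symm, if_pos rfl]; rfl
    · rw [hu, flipU, if_neg hd.ik.symm, if_neg hd.jk.symm, if_pos rfl]; rfl
    · rw [hw, flipW, if_neg hi, if_neg hj, if_neg hk]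
    · rw [hu, flipU, if_neg hi, if_neg hj, if_neg hk]

theorem existsUnique_isR (hs : s ^ 2 = q) (hd : Distinct i j k) (κ : Fin n → ℂˣ) :
    ∃! R : WeylFrac q n ≃ₐ[ℂ] WeylFrac q n, IsR q s κ i j k R := by
  have h := isWeyl q n
  have m := h.mem_range_lift_flip hs hd κ (lamNeZero hs hd κ)
  generalize h.flip hs hd κ (lamNeZero hs hd κ) = H at m
  obtain ⟨m1, m2, m3, m4, m5, m6⟩ := m
  have hmem_u : ∀ l, u q l ∈ H.lift.range ∨ l = k := by
    intro l
    by_cases hi : l = i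
    · rw [hi]; exact Or.inl m1
    by_cases hj : l = j
    · rw [hj]; exact Or.inl m2
    by_cases hk : l = k
    · exact Or.inr hk
    have := (H.mem_range_lift l).1.1
    rw [(flip_of_ne κ hi hj hk).1] at this
    exact Or.inl this
  have hmem_w : ∀ l, w q l ∈ H.lift.range ∨ l = i := by
    intro l
    by_cases hi : l = i
    · exact Or.inr hi
    by_cases hj : l = j
    · rw [hj]; exact Or.inl m5
    by_cases hk : l = k
    · rw [hk]; exact Or.inl m6
    have := (H.mem_range_lift l).2.1
    rw [(flip_of_ne κ hi hj hk).2] at this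
    exact Or.inl this
  have hinj : Function.Injective H.lift := by
    -- The exponents `-1` occur at `u k` and `w i`, whose inverses, but not yet they themselves, are
    -- known to lie in the range.
    refine WeylAlg.injective_of_mono_mem_range H.lift (fun l => if l = k then -1 else 1)
      (fun l => if l = i then -1 else 1) (fun l => by split_ifs <;> norm_num)
      (fun l => by split_ifs <;> norm_num) (fun l => ?_) fun l => ?_
    · rw [map_mono_u _ h.u_ne_zero, ofAlg_u]
      split_ifs with hl
      · rw [hl, zpow_neg_one]; exact m3
      · rw [zpow_one]; exact (hmem_u l).resolve_right hl
    · rw [map_mono_w _ h.w_ne_zero, ofAlg_w]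
      split_ifs with hl
      · rw [hl, zpow_neg_one]; exact m4
      · rw [zpow_one]; exact (hmem_w l).resolve_right hl
  obtain ⟨F, hF⟩ := exists_extension H.lift hinj
  -- `F` is defined on a skew field, so its range is closed under inverses. This recovers `u k` and
  -- `w i`, and then all fractions.
  have hinv : ∀ x ∈ F.range, x⁻¹ ∈ F.range := by
    rintro _ ⟨x, rfl⟩
    exact ⟨x⁻¹, map_inv₀ F x⟩
  have hle : H.lift.range ≤ F.range := by
    rintro _ ⟨x, rfl⟩
    exact ⟨_, hF x⟩
  have hu : ∀ l, u q l ∈ F.range := by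
    intro l
    by_cases hl : l = k
    · have := hinv _ (hle m3)
      rwa [inv_inv, ← hl] at this
    · exact hle ((hmem_u l).resolve_right hl)
  have hw : ∀ l, w q l ∈ F.range := by
    intro l
    by_cases hl : l = i
    · have := hinv _ (hle m4)
      rwa [inv_inv, ← hl] at this
    · exact hle ((hmem_w l).resolve_right hl)
  have hof : ∀ x, ofAlg q n x ∈ F.range := by
    have hlift : h.lift = ofAlg q n := by
      ext x
      induction x using WeylAlg.induction_on with
      | h0 => simp
      | hadd x y hx hy => simp only [map_add, hx, hy]
      | hm e a =>
        rw [h.lift_mono, h.map_mono (ofAlg q n) (fun _ => rfl) (fun _ => rfl)]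
    intro x
    rw [← hlift]
    exact h.lift_mem hu hw (fun l => hinv _ (hu l)) (fun l => hinv _ (hw l)) x
  have hsurj : Function.Surjective F := by
    intro x
    obtain ⟨r, t, -, rfl⟩ := exists_eq_inv_mul x
    exact F.range.mul_mem (hinv _ (hof t)) (hof r)
  have hR := (isR_iff (s := s) hd κ (AlgEquiv.ofBijective F ⟨F.toRingHom.injective, hsurj⟩)).2
    ⟨fun l => (hF _).trans (H.lift_u l), fun l => (hF _).trans (H.lift_w l)⟩
  refine ⟨_, hR, fun R' hR' => ?_⟩
  obtain ⟨a1, a2⟩ := (isR_iff hd κ _).1 hR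
  obtain ⟨b1, b2⟩ := (isR_iff hd κ _).1 hR'
  have := algHom_ext (f := (R' : WeylFrac q n →ₐ[ℂ] WeylFrac q n))
    (g := (AlgEquiv.ofBijective F ⟨F.toRingHom.injective, hsurj⟩ : WeylFrac q n →ₐ[ℂ] WeylFrac q n))
    (fun l => (b1 l).trans (a1 l).symm) (fun l => (b2 l).trans (a2 l).symm)
  ext x
  exact DFunLike.congr_fun this x

end WeylFrac

end existence

/-! ### The linear problem of one triangle -/

section triangle

variable {q s : ℂˣ} {n : ℕ} {D : Type*} [DivisionRing D] [Algebra ℂ D] {u w : Fin n → D}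
  {i j k : Fin n}

/-- Each `Λ` is multiplied so that the coefficients of the vertex forms appear. The three formulas
yield, in order, the fields `edge₂₃`, `edge₁₂` and `vertex₂` of `TriRel`. -/
theorem IsWeyl.lam_linear (h : IsWeyl q u w) (hs : s ^ 2 = q) (hd : Distinct i j k)
    (κ : Fin n → ℂˣ) :
    w j * lam3 s κ u w i j k * w k = w j * w i - (s : ℂ) • (w j * u k) + (κ k : ℂ) • (u k * w k) ∧
    (s : ℂ) ^ 2 • (u j * lam1 s κ u w i j k * u i) =
      (s : ℂ) ^ 2 • (u j * u k) + (κ i : ℂ) • (u i * w i) - (s : ℂ) • (u j * w i) ∧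
    (κ j : ℂ) • (u i * lam2 s κ u w i j k * (u j * w j)) = (κ i : ℂ) • (u i * (w k)⁻¹ * w j) +
      ((s : ℂ) ^ 2 * κ k) • u j - ((s : ℂ) * κ i * κ k) • u i := by
  obtain ⟨e1, e2, e3, e4, e5, e6, e7, e8, e9, e10, e11, e12⟩ :=
    h.mon_eqs (i := i) (j := j) (k := k)
  obtain ⟨l1, l2, l3⟩ := h.lam_eqs hs hd κ
  rw [l1, l2, l3, e12, e1, e2, e3, e4, e5, e6]
  simp only [mul_add, add_mul, mul_sub, sub_mul, smul_mul_assoc, mul_smul_comm, smul_smul,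
    smul_add, smul_sub, h.mon_mul hs hd]
  refine ⟨?_, ?_, ?_⟩ <;> norm_num <;> match_scalars <;> field_simp

/-- The coefficients `α` and `β` of the linear forms of a triangle and of the reversed triangle give
the same combination. -/
structure TriRel (s : ℂˣ) (κ : Fin n → ℂˣ) (i j k : Fin n) (u w U W : Fin n → D)
    (α₁ α₂ α₃ β₁ β₂ β₃ : D) : Prop where
  inner : w i * α₁ + α₂ + (s : ℂ) • u k * α₃ = 0
  inner' : (s : ℂ) • U i * β₁ + (κ j : ℂ) • (U j * W j) * β₂ + W k * β₃ = 0
  edge₁₂ : (s : ℂ) • U k * β₃ = (κ i : ℂ) • (u i * w i) * α₁ + (s : ℂ) • u j * α₂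
  edge₁₃ : β₂ = α₁ + α₃
  edge₂₃ : W i * β₁ = w j * α₂ + (κ k : ℂ) • (u k * w k) * α₃
  vertex₁ : (s : ℂ) • U j * β₂ + β₃ = (s : ℂ) • u i * α₁
  vertex₂ : (κ i : ℂ) • (U i * W i) * β₁ + (κ k : ℂ) • (U k * W k) * β₃ =
    (κ j : ℂ) • (u j * w j) * α₂
  vertex₃ : β₁ + W j * β₂ = w k * α₃

/-- This is `lam_identity_u` divided on the right by `a * b`, with `a = w j * lam3` and `b = u j *
lam1`; the commutations of `a` and `b` with each other and with the monomials permit the division.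
It is the identity that makes the new combination vanish on the reversed triangle. -/
theorem IsWeyl.flip_formula (h : IsWeyl q u w) (hs : s ^ 2 = q) (hd : Distinct i j k)
    (κ : Fin n → ℂˣ) (hne : LamNeZero s κ u w i j k) :
    (s : ℂ) • (u i * (w k)⁻¹ * flipW s κ i j k u w j) + (s : ℂ) • flipU s κ i j k u w j -
      (κ j : ℂ) • (u i * lam2 s κ u w i j k *
        (flipU s κ i j k u w j * flipW s κ i j k u w j)) = (s : ℂ) • u i := by
  obtain ⟨f1, f2, f3, f4, f5, f6⟩ := flip_eqs (s := s) h hd κ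
  have ha : w j * lam3 s κ u w i j k ≠ 0 := mul_ne_zero (h.w_ne_zero j) hne.lam3_ne_zero
  have hb : u j * lam1 s κ u w i j k ≠ 0 := mul_ne_zero (h.u_ne_zero j) hne.lam1_ne_zero
  have e1 := h.lam_identity_u hs hd κ
  obtain ⟨a1, a2, a3, b1, b2, b3, c1, c2, c3⟩ := h.qComm_lam_monomials hs hd κ
  obtain ⟨ab, ac, cb⟩ := h.qComm_lam hs hd κ
  rw [f2, f5]
  rw [qComm_zero] at a1 a2 b1 b2 ab
  generalize w j * lam3 s κ u w i j k = a at *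
  generalize u j * lam1 s κ u w i j k = b at *
  generalize u i * lam2 s κ u w i j k = c at *
  generalize w j * w i = M₁ at *
  generalize u j * u k = M₂ at *
  generalize u i * (w k)⁻¹ = M₃ at *
  have g1 : a⁻¹ * M₁ * (a * b) = M₁ * b := by
    rw [mul_assoc, ← mul_assoc M₁, ← a1, mul_assoc, inv_mul_cancel_left₀ ha]
  have g2 : b⁻¹ * M₂ * (a * b) = M₂ * a := by
    rw [ab, mul_assoc, ← mul_assoc M₂, ← b2, mul_assoc, inv_mul_cancel_left₀ hb]
  have g3 : b⁻¹ * M₂ * (M₁ * b) = M₂ * M₁ := by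
    rw [← b1, mul_assoc, ← mul_assoc M₂, ← b2, mul_assoc, inv_mul_cancel_left₀ hb]
  refine mul_right_cancel₀ (mul_ne_zero ha hb) ?_
  simp only [add_mul, sub_mul, smul_mul_assoc, mul_assoc c, mul_assoc M₃]
  rw [mul_assoc (b⁻¹ * M₂), g1, g2, g3, ← mul_assoc M₃, ← mul_assoc (u i), e1]

/-- The fields `edge₁₃`, `vertex₃` and `vertex₁` force the witnesses `β₂ = α₁ + α₃`, then `β₁` and
`β₃`. Of the rest, `inner'` and `vertex₂` are checked after left multiplication by `c = u i * lam2`,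
which turns `U i` into `u i * (w k)⁻¹` and `W k` into `1`. -/
theorem IsWeyl.exists_triRel (h : IsWeyl q u w) (hs : s ^ 2 = q) (hd : Distinct i j k)
    (κ : Fin n → ℂˣ) (hne : LamNeZero s κ u w i j k) (α₁ α₂ α₃ : D)
    (h0 : w i * α₁ + α₂ + (s : ℂ) • u k * α₃ = 0) :
    ∃ β₁ β₂ β₃, TriRel s κ i j k u w (flipU s κ i j k u w) (flipW s κ i j k u w)
      α₁ α₂ α₃ β₁ β₂ β₃ := by
  obtain ⟨f1, f2, f3, f4, f5, f6⟩ := flip_eqs (s := s) h hd κ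
  have H := h.flip hs hd κ hne
  have hq : (q : ℂ) = (s : ℂ) ^ 2 := by rw [← hs]; simp
  have hu := h.flip_formula hs hd κ hne
  obtain ⟨l1, l2, l3⟩ := h.lam_linear hs hd κ
  have ha : w j * lam3 s κ u w i j k ≠ 0 := mul_ne_zero (h.w_ne_zero j) hne.lam3_ne_zero
  have hb : u j * lam1 s κ u w i j k ≠ 0 := mul_ne_zero (h.u_ne_zero j) hne.lam1_ne_zero
  have hc : u i * lam2 s κ u w i j k ≠ 0 := mul_ne_zero (h.u_ne_zero i) hne.lam2_ne_zero
  have hα : α₂ = -(w i * α₁) - (s : ℂ) • (u k * α₃) := by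
    rw [smul_mul_assoc] at h0
    linear_combination (norm := module) h0
  have p1 : flipW s κ i j k u w i * flipW s κ i j k u w j = w j * w i := by
    rw [f1, f2, mul_inv_cancel_left₀ ha]
  have p2 : flipU s κ i j k u w k * flipU s κ i j k u w j = u j * u k := by
    rw [f6, f5, mul_inv_cancel_left₀ hb]
  have p3 : u i * lam2 s κ u w i j k * flipU s κ i j k u w i = u i * (w k)⁻¹ := by
    rw [f4, mul_inv_cancel_left₀ hc]
  have p4 : u i * lam2 s κ u w i j k * flipW s κ i j k u w k = 1 := by
    rw [f3, mul_inv_cancel₀ hc]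
  have p5 := H.u_mul_w_self k
  rw [← f1] at l1
  rw [← f6] at l2
  have hM3 : u i * (w k)⁻¹ * w k = u i := inv_mul_cancel_right₀ (h.w_ne_zero k) _
  have hM3' : u i * (w k)⁻¹ * (u k * w k) = (s : ℂ) ^ 2 • (u i * u k) := by
    rw [h.u_mul_w_self, mul_smul_comm, ← mul_assoc, hM3, hq]
  clear f1 f2 f3 f4 f5 f6
  generalize flipU s κ i j k u w = U at *
  generalize flipW s κ i j k u w = W at *
  generalize u i * lam2 s κ u w i j k = c at *
  have e23 : W i * (w k * α₃ - W j * (α₁ + α₃)) = w j * α₂ + (κ k : ℂ) • (u k * w k) * α₃ := by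
    rw [mul_sub, ← mul_assoc, ← mul_assoc, l1, p1, hα]
    simp only [mul_add, add_mul, mul_sub, sub_mul, mul_neg, smul_mul_assoc, mul_smul_comm,
      mul_assoc]
    module
  have e12 : (s : ℂ) • U k * ((s : ℂ) • u i * α₁ - (s : ℂ) • U j * (α₁ + α₃)) =
      (κ i : ℂ) • (u i * w i) * α₁ + (s : ℂ) • u j * α₂ := by
    have g1 : (s : ℂ) • U k * ((s : ℂ) • u i * α₁ - (s : ℂ) • U j * (α₁ + α₃)) =
        ((s : ℂ) ^ 2 • (U k * u i)) * α₁ - (s : ℂ) ^ 2 • (U k * U j * (α₁ + α₃)) := by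
      simp only [mul_add, mul_sub, smul_mul_assoc, mul_smul_comm, mul_assoc]
      module
    rw [g1, l2, p2, hα]
    simp only [mul_add, add_mul, mul_sub, sub_mul, mul_neg, smul_mul_assoc, mul_smul_comm,
      mul_assoc]
    module
  refine ⟨w k * α₃ - W j * (α₁ + α₃), α₁ + α₃, (s : ℂ) • u i * α₁ - (s : ℂ) • U j * (α₁ + α₃),
    h0, ?_, e12, rfl, e23, by abel, ?_, by abel⟩
  · refine mul_left_cancel₀ hc ?_
    rw [mul_zero]
    have g1 : ∀ β₁ β₂ β₃ : D,
        c * ((s : ℂ) • U i * β₁ + (κ j : ℂ) • (U j * W j) * β₂ + W k * β₃) =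
        (s : ℂ) • (c * U i * β₁) + (κ j : ℂ) • (c * (U j * W j)) * β₂ + c * W k * β₃ := by
      intro β₁ β₂ β₃
      simp only [mul_add, smul_mul_assoc, mul_smul_comm, mul_assoc]
    have g2 := congrArg (fun x => x * (α₁ + α₃)) hu
    have g3 : u i * (w k)⁻¹ * (w k * α₃) = u i * α₃ := by rw [← mul_assoc, hM3]
    rw [g1, p3, p4]
    simp only [mul_add, add_mul, mul_sub, sub_mul, smul_mul_assoc, mul_smul_comm, mul_assoc,
      one_mul] at g2 g3 ⊢
    linear_combination (norm := module) (s : ℂ) • g3 - g2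
  · generalize w k * α₃ - W j * (α₁ + α₃) = β₁ at *
    generalize (s : ℂ) • u i * α₁ - (s : ℂ) • U j * (α₁ + α₃) = β₃ at *
    refine mul_left_cancel₀ hc ?_
    have g1 : c * ((κ i : ℂ) • (U i * W i) * β₁ + (κ k : ℂ) • (U k * W k) * β₃) =
        (κ i : ℂ) • (c * U i * (W i * β₁)) + ((κ k : ℂ) * s) • (c * W k * ((s : ℂ) • U k * β₃)) := by
      rw [p5, hq]
      simp only [mul_add, smul_mul_assoc, mul_smul_comm, mul_assoc]
      module
    have g2 : c * ((κ j : ℂ) • (u j * w j) * α₂) = ((κ j : ℂ) • (c * (u j * w j))) * α₂ := by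
      simp only [smul_mul_assoc, mul_smul_comm, mul_assoc]
    rw [g1, g2, p3, p4, e12, e23, l3]
    have g3 : (s : ℂ) • u i * (w i * α₁ + α₂ + (s : ℂ) • u k * α₃) = 0 := by rw [h0, mul_zero]
    have g4 : u i * (w k)⁻¹ * (u k * w k) * α₃ = (s : ℂ) ^ 2 • (u i * u k) * α₃ := by rw [hM3']
    simp only [mul_add, add_mul, sub_mul, smul_mul_assoc, mul_smul_comm, mul_assoc, one_mul,
      smul_smul, smul_add] at g3 g4 ⊢
    linear_combination (norm := module) ((κ i : ℂ) * κ k) • g3 + ((κ i : ℂ) * κ k) • g4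

/-- Conversely, every combination for the reversed triangle is one for the triangle. -/
theorem IsWeyl.exists_triRel' (h : IsWeyl q u w) (hs : s ^ 2 = q) (hd : Distinct i j k)
    (κ : Fin n → ℂˣ) (hne : LamNeZero s κ u w i j k) (β₁ β₂ β₃ : D)
    (h0 : (s : ℂ) • flipU s κ i j k u w i * β₁ +
      (κ j : ℂ) • (flipU s κ i j k u w j * flipW s κ i j k u w j) * β₂ +
      flipW s κ i j k u w k * β₃ = 0) :
    ∃ α₁ α₂ α₃, TriRel s κ i j k u w (flipU s κ i j k u w) (flipW s κ i j k u w)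
      α₁ α₂ α₃ β₁ β₂ β₃ := by
  have hu := h.flip_formula hs hd κ hne
  have hc : u i * lam2 s κ u w i j k ≠ 0 := mul_ne_zero (h.u_ne_zero i) hne.lam2_ne_zero
  obtain ⟨f1, f2, f3, f4, f5, f6⟩ := flip_eqs (s := s) h hd κ
  have p3 : u i * lam2 s κ u w i j k * flipU s κ i j k u w i = u i * (w k)⁻¹ := by
    rw [f4, mul_inv_cancel_left₀ hc]
  have p4 : u i * lam2 s κ u w i j k * flipW s κ i j k u w k = 1 := by
    rw [f3, mul_inv_cancel₀ hc]
  -- `α₃` and `α₁` solve `vertex₃` and `vertex₁`, and `α₂` is then dictated by `inner`. The forward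
  -- direction returns some `γ`, which has to be identified with `β`.
  set α₃ := (w k)⁻¹ * (β₁ + flipW s κ i j k u w j * β₂) with hα₃
  set α₁ := (s : ℂ)⁻¹ • ((u i)⁻¹ * ((s : ℂ) • flipU s κ i j k u w j * β₂ + β₃)) with hα₁
  obtain ⟨γ₁, γ₂, γ₃, hγ⟩ := h.exists_triRel hs hd κ hne α₁ (-(w i * α₁) - (s : ℂ) • u k * α₃) α₃
    (by abel)
  have v1 := hγ.vertex₁
  have v3 := hγ.vertex₃
  have v0 := hγ.inner'
  rw [hα₁, smul_mul_smul_comm, mul_inv_cancel₀ s.ne_zero, one_smul,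
    mul_inv_cancel_left₀ (h.u_ne_zero i)] at v1
  rw [hα₃, mul_inv_cancel_left₀ (h.w_ne_zero k)] at v3
  -- Both `γ` and `β` satisfy `inner'` and the two vertex equations. Subtracting, `flip_formula`
  -- collapses the difference to `s • (u i * (γ₂ - β₂)) = 0`.
  have key : γ₂ = β₂ := by
    have k1 := congrArg (fun x => u i * lam2 s κ u w i j k * x) h0
    have k0 := congrArg (fun x => u i * lam2 s κ u w i j k * x) v0
    have e1 : γ₁ = β₁ + flipW s κ i j k u w j * β₂ - flipW s κ i j k u w j * γ₂ := by
      rw [← v3]; abel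
    have e3 : γ₃ = (s : ℂ) • flipU s κ i j k u w j * β₂ + β₃ -
        (s : ℂ) • flipU s κ i j k u w j * γ₂ := by
      rw [← v1]; abel
    have g1 : ∀ β₁ β₂ β₃ : D, u i * lam2 s κ u w i j k * ((s : ℂ) • flipU s κ i j k u w i * β₁ +
        (κ j : ℂ) • (flipU s κ i j k u w j * flipW s κ i j k u w j) * β₂ +
        flipW s κ i j k u w k * β₃) =
        (s : ℂ) • (u i * (w k)⁻¹ * β₁) + (κ j : ℂ) • (u i * lam2 s κ u w i j k *
          (flipU s κ i j k u w j * flipW s κ i j k u w j)) * β₂ + β₃ := by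
      intro β₁ β₂ β₃
      rw [← p3, mul_add, ← mul_assoc _ (flipW s κ i j k u w k), p4, one_mul]
      simp only [mul_add, smul_mul_assoc, mul_smul_comm, mul_assoc]
    rw [e1, e3] at k0
    simp only [g1, mul_zero] at k0 k1
    have k2 := congrArg (fun x => x * (γ₂ - β₂)) hu
    have k3 : (s : ℂ) • (u i * (γ₂ - β₂)) = 0 := by
      simp only [mul_add, add_mul, mul_sub, sub_mul, smul_mul_assoc, mul_assoc, smul_sub,
        smul_add] at k0 k1 k2 ⊢
      linear_combination (norm := module) k1 - k0 - k2
    have k4 := (smul_eq_zero.1 k3).resolve_left s.ne_zero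
    exact sub_eq_zero.1 ((mul_eq_zero.1 k4).resolve_left (h.u_ne_zero i))
  subst key
  obtain rfl := add_right_cancel v3
  obtain rfl := add_left_cancel v1
  exact ⟨_, _, _, hγ⟩

end triangle

/-! ### Four lines and the reversal of each of their triangles -/

section tetrahedron

variable {q s : ℂˣ} {D : Type*} [DivisionRing D] [Algebra ℂ D]

/-- The coefficients of the linear form of a vertex at the four adjacent faces, which are given by
their sides with respect to the two lines through the vertex. -/
def corner (s κ : ℂˣ) (u w : D) : Bool → Bool → D
  | true, true => w
  | false, false => (s : ℂ) • u
  | false, true => (κ : ℂ) • (u * w)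
  | true, false => 1

section triangle

variable {n : ℕ} {u w : Fin n → D} {i j k : Fin n}

/-- The value at the face `(a, b, c)` of a combination of the linear forms at the vertices of a
triangle; the triangle is on the side `t` of its lines. -/
def tri (s : ℂˣ) (κ : Fin n → ℂˣ) (u w : Fin n → D) (i j k : Fin n) (t : Bool) (α₁ α₂ α₃ : D)
    (a b c : Bool) : D :=
  (if c = t then corner s (κ i) (u i) (w i) a b * α₁ else 0) +
  (if b = t then corner s (κ j) (u j) (w j) a (!c) * α₂ else 0) +
  (if a = t then corner s (κ k) (u k) (w k) (!b) (!c) * α₃ else 0)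

/-- The eight fields are the eight labels. The label `(true, true, true)` belongs to no face of the
reversed triangle and `(false, false, false)` to none of the original one, so `inner` and `inner'`
state vanishing. -/
theorem TriRel.tri_eq {κ : Fin n → ℂˣ} {U W : Fin n → D} {α₁ α₂ α₃ β₁ β₂ β₃ : D}
    (h : TriRel s κ i j k u w U W α₁ α₂ α₃ β₁ β₂ β₃) :
    tri s κ u w i j k true α₁ α₂ α₃ = tri s κ U W i j k false β₁ β₂ β₃ := by
  funext a b c
  rcases a <;> rcases b <;> rcases c <;> simp [tri, corner]
  · simpa using h.inner'.symm
  · simpa using h.vertex₁.symm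
  · simpa using h.vertex₂.symm
  · simpa using h.edge₁₂.symm
  · simpa using h.vertex₃.symm
  · simpa using h.edge₁₃.symm
  · simpa using h.edge₂₃.symm
  · simpa using h.inner

theorem IsWeyl.exists_tri (h : IsWeyl q u w) (hs : s ^ 2 = q) (hd : Distinct i j k)
    (κ : Fin n → ℂˣ) (hne : LamNeZero s κ u w i j k) (α₁ α₂ α₃ : D)
    (h0 : tri s κ u w i j k true α₁ α₂ α₃ true true true = 0) :
    ∃ β₁ β₂ β₃, tri s κ u w i j k true α₁ α₂ α₃ =
      tri s κ (flipU s κ i j k u w) (flipW s κ i j k u w) i j k false β₁ β₂ β₃ := by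
  obtain ⟨β₁, β₂, β₃, hβ⟩ := h.exists_triRel hs hd κ hne α₁ α₂ α₃ (by
    simpa [tri, corner] using h0)
  exact ⟨_, _, _, hβ.tri_eq⟩

theorem IsWeyl.exists_tri' (h : IsWeyl q u w) (hs : s ^ 2 = q) (hd : Distinct i j k)
    (κ : Fin n → ℂˣ) (hne : LamNeZero s κ u w i j k) (β₁ β₂ β₃ : D)
    (h0 : tri s κ (flipU s κ i j k u w) (flipW s κ i j k u w) i j k false β₁ β₂ β₃
      false false false = 0) :
    ∃ α₁ α₂ α₃, tri s κ u w i j k true α₁ α₂ α₃ =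
      tri s κ (flipU s κ i j k u w) (flipW s κ i j k u w) i j k false β₁ β₂ β₃ := by
  obtain ⟨β₁, β₂, β₃, hβ⟩ := h.exists_triRel' hs hd κ hne β₁ β₂ β₃ (by
    simpa [tri, corner] using h0)
  exact ⟨_, _, _, hβ.tri_eq⟩

end triangle

/-- The value at the face `(a, b, c, d)` of a combination of the linear forms at the six vertices
of four lines. The position of every vertex is given by its sides with respect to the two lines
that do not meet it. -/
def tot (s : ℂˣ) (κ : Fin 6 → ℂˣ) (u w : Fin 6 → D) (p : Fin 6 → Bool × Bool) (α : Fin 6 → D)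
    (a b c d : Bool) : D :=
  (if c = (p 0).1 ∧ d = (p 0).2 then corner s (κ 0) (u 0) (w 0) a b * α 0 else 0) +
  (if b = (p 1).1 ∧ d = (p 1).2 then corner s (κ 1) (u 1) (w 1) a (!c) * α 1 else 0) +
  (if a = (p 2).1 ∧ d = (p 2).2 then corner s (κ 2) (u 2) (w 2) (!b) (!c) * α 2 else 0) +
  (if b = (p 3).1 ∧ c = (p 3).2 then corner s (κ 3) (u 3) (w 3) a (!d) * α 3 else 0) +
  (if a = (p 4).1 ∧ c = (p 4).2 then corner s (κ 4) (u 4) (w 4) (!b) (!d) * α 4 else 0) +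
  (if a = (p 5).1 ∧ b = (p 5).2 then corner s (κ 5) (u 5) (w 5) c (!d) * α 5 else 0)

/-- The functions on faces that are combinations of the linear forms of the six vertices. -/
def Combination (s : ℂˣ) (κ : Fin 6 → ℂˣ) (u w : Fin 6 → D) (p : Fin 6 → Bool × Bool)
    (m : Bool → Bool → Bool → Bool → D) : Prop :=
  ∃ α, tot s κ u w p α = m

variable {u w : Fin 6 → D}

/-- The vertices `3, 4, 5` lie on the fourth line, and the pattern `(x, !x)` of their positions
keeps them away from the labels in `h0` and `h1`. There `m` is the contribution of the triangle
alone, so the triangle can be replaced while the other coefficients stay fixed. -/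
theorem combination_flip_123 (h : IsWeyl q u w) (hs : s ^ 2 = q) (κ : Fin 6 → ℂˣ)
    (hne : LamNeZero s κ u w 0 1 2) (t x₃ x₄ x₅ : Bool) (m : Bool → Bool → Bool → Bool → D)
    (h0 : m true true true t = 0) (h1 : m false false false t = 0) :
    Combination s κ u w ![(true, t), (true, t), (true, t), (x₃, !x₃), (x₄, !x₄), (x₅, !x₅)] m ↔
    Combination s κ (flipU s κ 0 1 2 u w) (flipW s κ 0 1 2 u w)
      ![(false, t), (false, t), (false, t), (x₃, !x₃), (x₄, !x₄), (x₅, !x₅)] m := by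
  have hd : Distinct (0 : Fin 6) 1 2 := ⟨by decide, by decide, by decide⟩
  have g3 := flip_of_ne (u := u) (w := w) (s := s) (i := 0) (j := 1) (k := 2) (l := 3) κ
    (by decide) (by decide) (by decide)
  have g4 := flip_of_ne (u := u) (w := w) (s := s) (i := 0) (j := 1) (k := 2) (l := 4) κ
    (by decide) (by decide) (by decide)
  have g5 := flip_of_ne (u := u) (w := w) (s := s) (i := 0) (j := 1) (k := 2) (l := 5) κ
    (by decide) (by decide) (by decide)
  constructor
  · rintro ⟨α, rfl⟩
    obtain ⟨β₁, β₂, β₃, hβ⟩ := h.exists_tri hs hd κ hne (α 0) (α 1) (α 2) (by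
      rw [← h0]
      rcases t <;> rcases x₃ <;> rcases x₄ <;> rcases x₅ <;> simp [tot, tri])
    refine ⟨![β₁, β₂, β₃, α 3, α 4, α 5], ?_⟩
    funext a b c d
    have := congrFun (congrFun (congrFun hβ a) b) c
    simp only [tri] at this
    -- The triangle lies on the side `t` of the fourth line; on the other side its vertices
    -- contribute nothing, before or after.
    by_cases hdt : d = t
    · simp [tot, g3, g4, g5, hdt] at this ⊢
      linear_combination (norm := skip) -this
      rcases a <;> rcases b <;> rcases c <;> rcases d <;> simp <;> abel
    · simp [tot, g3, g4, g5, hdt]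
      congr!
  · rintro ⟨β, rfl⟩
    obtain ⟨α₁, α₂, α₃, hα⟩ := h.exists_tri' hs hd κ hne (β 0) (β 1) (β 2) (by
      rw [← h1]
      rcases t <;> rcases x₃ <;> rcases x₄ <;> rcases x₅ <;> simp [tot, tri])
    refine ⟨![α₁, α₂, α₃, β 3, β 4, β 5], ?_⟩
    funext a b c d
    have := congrFun (congrFun (congrFun hα a) b) c
    simp only [tri] at this
    by_cases hdt : d = t
    · simp [tot, g3, g4, g5, hdt] at this ⊢
      linear_combination (norm := skip) this
      rcases a <;> rcases b <;> rcases c <;> rcases d <;> simp <;> abel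
    · simp [tot, g3, g4, g5, hdt]
      congr!

theorem combination_flip_145 (h : IsWeyl q u w) (hs : s ^ 2 = q) (κ : Fin 6 → ℂˣ)
    (hne : LamNeZero s κ u w 0 3 4) (t x₁ x₂ x₅ : Bool) (m : Bool → Bool → Bool → Bool → D)
    (h0 : m true true t true = 0) (h1 : m false false t false = 0) :
    Combination s κ u w ![(t, true), (x₁, !x₁), (x₂, !x₂), (true, t), (true, t), (x₅, !x₅)] m ↔
    Combination s κ (flipU s κ 0 3 4 u w) (flipW s κ 0 3 4 u w)
      ![(t, false), (x₁, !x₁), (x₂, !x₂), (false, t), (false, t), (x₅, !x₅)] m := by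
  have hd : Distinct (0 : Fin 6) 3 4 := ⟨by decide, by decide, by decide⟩
  have g1 := flip_of_ne (u := u) (w := w) (s := s) (i := 0) (j := 3) (k := 4) (l := 1) κ
    (by decide) (by decide) (by decide)
  have g2 := flip_of_ne (u := u) (w := w) (s := s) (i := 0) (j := 3) (k := 4) (l := 2) κ
    (by decide) (by decide) (by decide)
  have g5 := flip_of_ne (u := u) (w := w) (s := s) (i := 0) (j := 3) (k := 4) (l := 5) κ
    (by decide) (by decide) (by decide)
  constructor
  · rintro ⟨α, rfl⟩
    obtain ⟨β₁, β₂, β₃, hβ⟩ := h.exists_tri hs hd κ hne (α 0) (α 3) (α 4) (by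
      rw [← h0]
      rcases t <;> rcases x₁ <;> rcases x₂ <;> rcases x₅ <;> simp [tot, tri])
    refine ⟨![β₁, α 1, α 2, β₂, β₃, α 5], ?_⟩
    funext a b c d
    have := congrFun (congrFun (congrFun hβ a) b) d
    simp only [tri] at this
    by_cases hdt : c = t
    · simp [tot, g1, g2, g5, hdt] at this ⊢
      linear_combination (norm := skip) -this
      rcases a <;> rcases b <;> rcases c <;> rcases d <;> simp <;> abel
    · simp [tot, g1, g2, g5, hdt]
      congr!
  · rintro ⟨β, rfl⟩
    obtain ⟨α₁, α₂, α₃, hα⟩ := h.exists_tri' hs hd κ hne (β 0) (β 3) (β 4) (by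
      rw [← h1]
      rcases t <;> rcases x₁ <;> rcases x₂ <;> rcases x₅ <;> simp [tot, tri])
    refine ⟨![α₁, β 1, β 2, α₂, α₃, β 5], ?_⟩
    funext a b c d
    have := congrFun (congrFun (congrFun hα a) b) d
    simp only [tri] at this
    by_cases hdt : c = t
    · simp [tot, g1, g2, g5, hdt] at this ⊢
      linear_combination (norm := skip) this
      rcases a <;> rcases b <;> rcases c <;> rcases d <;> simp <;> abel
    · simp [tot, g1, g2, g5, hdt]
      congr!

/-- In `tot` the vertices `1, 3, 5` use the corners `(a, !c)`, `(a, !d)`, `(c, !d)`, which are those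
of `tri` at `(a, !c, d)`. Hence the side of the line `c` is read in reverse. -/
theorem combination_flip_246 (h : IsWeyl q u w) (hs : s ^ 2 = q) (κ : Fin 6 → ℂˣ)
    (hne : LamNeZero s κ u w 1 3 5) (t x₀ x₂ x₄ : Bool) (m : Bool → Bool → Bool → Bool → D)
    (h0 : m true t false true = 0) (h1 : m false t true false = 0) :
    Combination s κ u w ![(x₀, x₀), (t, true), (x₂, !x₂), (t, false), (x₄, x₄), (true, t)] m ↔
    Combination s κ (flipU s κ 1 3 5 u w) (flipW s κ 1 3 5 u w)
      ![(x₀, x₀), (t, false), (x₂, !x₂), (t, true), (x₄, x₄), (false, t)] m := by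
  have hd : Distinct (1 : Fin 6) 3 5 := ⟨by decide, by decide, by decide⟩
  have g0 := flip_of_ne (u := u) (w := w) (s := s) (i := 1) (j := 3) (k := 5) (l := 0) κ
    (by decide) (by decide) (by decide)
  have g2 := flip_of_ne (u := u) (w := w) (s := s) (i := 1) (j := 3) (k := 5) (l := 2) κ
    (by decide) (by decide) (by decide)
  have g4 := flip_of_ne (u := u) (w := w) (s := s) (i := 1) (j := 3) (k := 5) (l := 4) κ
    (by decide) (by decide) (by decide)
  constructor
  · rintro ⟨α, rfl⟩
    obtain ⟨β₁, β₂, β₃, hβ⟩ := h.exists_tri hs hd κ hne (α 1) (α 3) (α 5) (by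
      rw [← h0]
      rcases t <;> rcases x₀ <;> rcases x₂ <;> rcases x₄ <;> simp [tot, tri])
    refine ⟨![α 0, β₁, α 2, β₂, α 4, β₃], ?_⟩
    funext a b c d
    have := congrFun (congrFun (congrFun hβ a) (!c)) d
    simp only [tri] at this
    by_cases hdt : b = t
    · simp [tot, g0, g2, g4, hdt] at this ⊢
      linear_combination (norm := skip) -this
      rcases a <;> rcases b <;> rcases c <;> rcases d <;> simp <;> abel
    · simp [tot, g0, g2, g4, hdt]
      congr!
  · rintro ⟨β, rfl⟩
    obtain ⟨α₁, α₂, α₃, hα⟩ := h.exists_tri' hs hd κ hne (β 1) (β 3) (β 5) (by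
      rw [← h1]
      rcases t <;> rcases x₀ <;> rcases x₂ <;> rcases x₄ <;> simp [tot, tri])
    refine ⟨![β 0, α₁, β 2, α₂, β 4, α₃], ?_⟩
    funext a b c d
    have := congrFun (congrFun (congrFun hα a) (!c)) d
    simp only [tri] at this
    by_cases hdt : b = t
    · simp [tot, g0, g2, g4, hdt] at this ⊢
      linear_combination (norm := skip) this
      rcases a <;> rcases b <;> rcases c <;> rcases d <;> simp <;> abel
    · simp [tot, g0, g2, g4, hdt]
      congr!

/-- The corners of the vertices `2, 4, 5` are those of `tri` at `(!b, !c, d)`, so the sides of both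
`b` and `c` are read in reverse. -/
theorem combination_flip_356 (h : IsWeyl q u w) (hs : s ^ 2 = q) (κ : Fin 6 → ℂˣ)
    (hne : LamNeZero s κ u w 2 4 5) (t x₀ x₁ x₃ : Bool) (m : Bool → Bool → Bool → Bool → D)
    (h0 : m t false false true = 0) (h1 : m t true true false = 0) :
    Combination s κ u w ![(x₀, x₀), (x₁, x₁), (t, true), (x₃, !x₃), (t, false), (t, false)] m ↔
    Combination s κ (flipU s κ 2 4 5 u w) (flipW s κ 2 4 5 u w)
      ![(x₀, x₀), (x₁, x₁), (t, false), (x₃, !x₃), (t, true), (t, true)] m := by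
  have hd : Distinct (2 : Fin 6) 4 5 := ⟨by decide, by decide, by decide⟩
  have g0 := flip_of_ne (u := u) (w := w) (s := s) (i := 2) (j := 4) (k := 5) (l := 0) κ
    (by decide) (by decide) (by decide)
  have g1 := flip_of_ne (u := u) (w := w) (s := s) (i := 2) (j := 4) (k := 5) (l := 1) κ
    (by decide) (by decide) (by decide)
  have g3 := flip_of_ne (u := u) (w := w) (s := s) (i := 2) (j := 4) (k := 5) (l := 3) κ
    (by decide) (by decide) (by decide)
  constructor
  · rintro ⟨α, rfl⟩
    obtain ⟨β₁, β₂, β₃, hβ⟩ := h.exists_tri hs hd κ hne (α 2) (α 4) (α 5) (by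
      rw [← h0]
      rcases t <;> rcases x₀ <;> rcases x₁ <;> rcases x₃ <;> simp [tot, tri])
    refine ⟨![α 0, α 1, β₁, α 3, β₂, β₃], ?_⟩
    funext a b c d
    have := congrFun (congrFun (congrFun hβ (!b)) (!c)) d
    simp only [tri] at this
    by_cases hdt : a = t
    · simp [tot, g0, g1, g3, hdt] at this ⊢
      linear_combination (norm := skip) -this
      rcases a <;> rcases b <;> rcases c <;> rcases d <;> simp <;> abel
    · simp [tot, g0, g1, g3, hdt]
      congr!
  · rintro ⟨β, rfl⟩
    obtain ⟨α₁, α₂, α₃, hα⟩ := h.exists_tri' hs hd κ hne (β 2) (β 4) (β 5) (by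
      rw [← h1]
      rcases t <;> rcases x₀ <;> rcases x₁ <;> rcases x₃ <;> simp [tot, tri])
    refine ⟨![β 0, β 1, α₁, β 3, α₂, α₃], ?_⟩
    funext a b c d
    have := congrFun (congrFun (congrFun hα (!b)) (!c)) d
    simp only [tri] at this
    by_cases hdt : a = t
    · simp [tot, g0, g1, g3, hdt] at this ⊢
      linear_combination (norm := skip) this
      rcases a <;> rcases b <;> rcases c <;> rcases d <;> simp <;> abel
    · simp [tot, g0, g1, g3, hdt]
      congr!

end tetrahedron

/-! ### The combinations determine the Weyl pairs -/

section uniqueness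

variable {q s : ℂˣ} {D : Type*} [DivisionRing D] [Algebra ℂ D] {u w U W : Fin 6 → D}

/-- The coefficients `α` and `β` of the linear forms of the six vertices, in the position reached
after all four triangles are reversed, give the same combination, and this combination vanishes at
the inner faces. -/
structure FaceRel (s : ℂˣ) (κ : Fin 6 → ℂˣ) (u w U W : Fin 6 → D)
    (α₀ α₁ α₂ α₃ α₄ α₅ β₀ β₁ β₂ β₃ β₄ β₅ : D) : Prop where
  inner₁ : (s : ℂ) • U 0 * β₀ + (κ 1 : ℂ) • (U 1 * W 1) * β₁ + W 2 * β₂ = 0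
  inner₂ : (s : ℂ) • U 1 * β₁ + β₂ + (κ 3 : ℂ) • (U 3 * W 3) * β₃ + W 4 * β₄ = 0
  inner₃ : (s : ℂ) • U 2 * β₂ + (κ 4 : ℂ) • (U 4 * W 4) * β₄ + W 5 * β₅ = 0
  outer₁ : β₀ + W 1 * β₁ = α₀ + w 1 * α₁
  outer₂ : (κ 0 : ℂ) • (U 0 * W 0) * β₀ + (κ 2 : ℂ) • (U 2 * W 2) * β₂ +
      (κ 5 : ℂ) • (U 5 * W 5) * β₅ = (κ 0 : ℂ) • (u 0 * w 0) * α₀ +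
      (κ 2 : ℂ) • (u 2 * w 2) * α₂ + (κ 5 : ℂ) • (u 5 * w 5) * α₅
  outer₃ : W 0 * β₀ = w 0 * α₀
  outer₄ : β₁ + W 3 * β₃ = α₁ + w 3 * α₃
  outer₅ : (s : ℂ) • U 3 * β₃ + β₄ = (s : ℂ) • u 3 * α₃ + α₄
  outer₆ : β₃ = α₃
  outer₇ : U 5 * β₅ = u 5 * α₅
  outer₈ : (s : ℂ) • U 4 * β₄ + β₅ = (s : ℂ) • u 4 * α₄ + α₅

/-- Six coefficients are subject to three equations at the bounded faces. Three test combinations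
suffice, chosen so sparse that the outer faces force most of the `β` to vanish and the remaining
equations give the pairs one at a time. Only `U 4` and `W 1` need a cancellation by `hne₂` and
`hne₁`. -/
theorem IsWeyl.eq_of_faceRel (h : IsWeyl q u w) (H : IsWeyl q U W) (κ : Fin 6 → ℂˣ)
    (hne₁ : (κ 1 : ℂ) • u 1 - (s : ℂ) • u 0 ≠ 0) (hne₂ : (κ 4 : ℂ) • w 4 - (s : ℂ) • w 5 ≠ 0)
    (hr : ∀ α₀ α₁ α₂ α₃ α₄ α₅,
      (s : ℂ) • u 0 * α₀ + (κ 1 : ℂ) • (u 1 * w 1) * α₁ + w 2 * α₂ = 0 →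
      (s : ℂ) • u 1 * α₁ + α₂ + (κ 3 : ℂ) • (u 3 * w 3) * α₃ + w 4 * α₄ = 0 →
      (s : ℂ) • u 2 * α₂ + (κ 4 : ℂ) • (u 4 * w 4) * α₄ + w 5 * α₅ = 0 →
      ∃ β₀ β₁ β₂ β₃ β₄ β₅, FaceRel s κ u w U W α₀ α₁ α₂ α₃ α₄ α₅ β₀ β₁ β₂ β₃ β₄ β₅) :
    U = u ∧ W = w := by
  have hu := h.u_ne_zero
  have hw := h.w_ne_zero
  have hU := H.u_ne_zero
  have hW := H.w_ne_zero
  have hs0 := s.ne_zero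
  have hsu : ∀ i, (s : ℂ) • u i ≠ 0 := fun i => smul_ne_zero hs0 (hu i)
  have hsU : ∀ i, (s : ℂ) • U i ≠ 0 := fun i => smul_ne_zero hs0 (hU i)
  have hκ : ∀ i, (κ i : ℂ) • (u i * w i) ≠ 0 := fun i =>
    smul_ne_zero (κ i).ne_zero (mul_ne_zero (hu i) (hw i))
  have cancel : ∀ {x y z : D}, z ≠ 0 → x * z = y * z → x = y := fun hz => mul_right_cancel₀ hz
  have scancel : ∀ {c : ℂˣ} {x y : D}, (c : ℂ) • x = (c : ℂ) • y → x = y := fun {c} x y hxy =>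
    (smul_right_injective D c.ne_zero) hxy
  have mul0 : ∀ {x y : D}, x ≠ 0 → x * y = 0 → y = 0 := fun hx hxy =>
    (mul_eq_zero.1 hxy).resolve_left hx
  -- a combination supported on the line through the vertices `0, 1, 3`
  obtain ⟨a, ha⟩ : ∃ a, a = -(((s : ℂ) • u 0)⁻¹ * ((κ 1 : ℂ) • (u 1 * w 1))) := ⟨_, rfl⟩
  obtain ⟨d, hd⟩ : ∃ d, d = -(((κ 3 : ℂ) • (u 3 * w 3))⁻¹ * ((s : ℂ) • u 1)) := ⟨_, rfl⟩
  have ha0 : a ≠ 0 := by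
    rw [ha]; exact neg_ne_zero.2 (mul_ne_zero (inv_ne_zero (hsu 0)) (hκ 1))
  have hd0 : d ≠ 0 := by
    rw [hd]; exact neg_ne_zero.2 (mul_ne_zero (inv_ne_zero (hκ 3)) (hsu 1))
  have ha' : (s : ℂ) • u 0 * a = -((κ 1 : ℂ) • (u 1 * w 1)) := by
    rw [ha, mul_neg, mul_inv_cancel_left₀ (hsu 0)]
  have hd' : (κ 3 : ℂ) • (u 3 * w 3) * d = -((s : ℂ) • u 1) := by
    rw [hd, mul_neg, mul_inv_cancel_left₀ (hκ 3)]
  obtain ⟨β₀, β₁, β₂, β₃, β₄, β₅, A⟩ := hr a 1 0 d 0 0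
    (by rw [ha', mul_one, mul_zero]; abel) (by rw [hd', mul_one, mul_zero]; abel) (by simp)
  obtain ⟨T1, Q, T2, oA, oB, oC, oE, oF, rfl, oH, oI⟩ := A
  obtain rfl : β₅ = 0 := mul0 (hU 5) (by rw [oH, mul_zero])
  obtain rfl : β₄ = 0 := mul0 (hsU 4) (by simpa using oI)
  obtain rfl : β₂ = 0 := mul0 (hsU 2) (by simpa using T2)
  have hU3 : U 3 = u 3 := scancel (cancel hd0 (by simpa only [add_zero] using oF))
  have hU0 : U 0 = u 0 := by
    refine cancel (mul_ne_zero (hw 0) ha0) (scancel (c := κ 0) ?_)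
    simp only [mul_zero, add_zero, smul_mul_assoc, mul_assoc] at oB
    rwa [oC] at oB
  -- a combination supported on the line through the vertices `3, 4, 5`
  obtain ⟨e, he⟩ : ∃ e, e = -(((κ 3 : ℂ) • (u 3 * w 3))⁻¹ * w 4) := ⟨_, rfl⟩
  obtain ⟨f, hf⟩ : ∃ f, f = -((w 5)⁻¹ * ((κ 4 : ℂ) • (u 4 * w 4))) := ⟨_, rfl⟩
  have he0 : e ≠ 0 := by
    rw [he]; exact neg_ne_zero.2 (mul_ne_zero (inv_ne_zero (hκ 3)) (hw 4))
  have hf0 : f ≠ 0 := by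
    rw [hf]; exact neg_ne_zero.2 (mul_ne_zero (inv_ne_zero (hw 5)) (hκ 4))
  have he' : (κ 3 : ℂ) • (u 3 * w 3) * e = -w 4 := by
    rw [he, mul_neg, mul_inv_cancel_left₀ (hκ 3)]
  have hf' : w 5 * f = -((κ 4 : ℂ) • (u 4 * w 4)) := by
    rw [hf, mul_neg, mul_inv_cancel_left₀ (hw 5)]
  obtain ⟨γ₀, γ₁, γ₂, γ₃, γ₄, γ₅, A'⟩ := hr 0 0 0 e 1 f
    (by simp) (by rw [he', mul_one, mul_zero]; abel) (by rw [hf', mul_one, mul_zero]; abel)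
  obtain ⟨T1', Q', T2', oA', oB', oC', oE', oF', rfl, oH', oI'⟩ := A'
  obtain rfl : γ₀ = 0 := mul0 (hW 0) (by rw [oC', mul_zero])
  obtain rfl : γ₁ = 0 := mul0 (hW 1) (by simpa using oA')
  obtain rfl : γ₂ = 0 := mul0 (hW 2) (by simpa using T1')
  have hW3 : W 3 = w 3 := cancel he0 (by simpa only [zero_add] using oE')
  obtain rfl : γ₄ = 1 := by rw [hU3] at oF'; exact add_left_cancel oF'
  have hW4 : W 4 = w 4 := by
    rw [hU3, hW3, he'] at Q'
    have : -w 4 + W 4 = 0 := by simpa using Q'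
    exact (neg_add_eq_zero.1 this).symm
  have hW5 : W 5 = w 5 := by
    refine cancel (mul_ne_zero (hu 5) hf0) ?_
    simp only [mul_zero, zero_add, smul_mul_assoc] at oB'
    have := scancel oB'
    rw [H.u_mul_w_self, h.u_mul_w_self, smul_mul_assoc, smul_mul_assoc] at this
    have := scancel this
    rwa [mul_assoc, mul_assoc, oH'] at this
  -- Eliminating `γ₅` turns `inner₃` into `(U 4 - u 4) * (κ 4 • w 4 - s • w 5) = 0`.
  have hU4 : U 4 = u 4 := by
    refine cancel hne₂ ?_
    have c1 := H.u_mul_w_of_ne 4 5 (by decide)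
    have c2 := h.u_mul_w_of_ne 4 5 (by decide)
    have e1 : γ₅ = (s : ℂ) • u 4 + f - (s : ℂ) • U 4 := by
      rw [mul_one, mul_one] at oI'
      rw [← oI']; abel
    rw [e1, hW4, hW5] at T2'
    rw [hW5] at c1
    simp only [mul_one, mul_zero, zero_add, mul_add, mul_sub, mul_smul_comm, hf', ← c1,
      ← c2] at T2' ⊢
    linear_combination (norm := module) T2'
  obtain rfl : γ₅ = f := by rw [hU4] at oI'; exact add_left_cancel oI'
  have hU5 : U 5 = u 5 := cancel hf0 oH'
  -- Back to the first combination, now that `W 3` is known.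
  obtain rfl : β₁ = 1 := by rw [hW3] at oE; exact add_right_cancel oE
  have hU1 : U 1 = u 1 := by
    rw [hU3, hW3, hd'] at Q
    have : (s : ℂ) • U 1 - (s : ℂ) • u 1 = 0 := by simpa [sub_eq_add_neg] using Q
    exact scancel (sub_eq_zero.1 this)
  -- Eliminating `β₀` turns `inner₁` into `(κ 1 • u 1 - s • u 0) * (W 1 - w 1) = 0`.
  have hW1 : W 1 = w 1 := by
    refine mul_left_cancel₀ hne₁ ?_
    have e1 : β₀ = a + w 1 - W 1 := by
      rw [mul_one, mul_one] at oA
      rw [← oA]; abel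
    rw [hU0, hU1, e1, mul_sub, mul_add, ha'] at T1
    simp only [mul_one, mul_zero, add_zero, sub_mul, smul_mul_assoc] at T1 ⊢
    linear_combination (norm := module) T1
  obtain rfl : β₀ = a := by rw [hW1] at oA; exact add_right_cancel oA
  have hW0 : W 0 = w 0 := cancel ha0 oC
  -- a combination that involves the vertex `2`
  obtain ⟨δ₀, δ₁, δ₂, δ₃, δ₄, δ₅, A''⟩ := hr (-(((s : ℂ) • u 0)⁻¹ * w 2)) 0 1
    (-((κ 3 : ℂ) • (u 3 * w 3))⁻¹) 0 (-((w 5)⁻¹ * ((s : ℂ) • u 2)))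
    (by rw [mul_neg, mul_inv_cancel_left₀ (hsu 0)]; simp)
    (by rw [mul_neg, mul_inv_cancel₀ (hκ 3)]; simp)
    (by rw [mul_neg, mul_inv_cancel_left₀ (hw 5)]; simp)
  obtain ⟨T1'', Q'', T2'', oA'', oB'', oC'', oE'', oF'', rfl, oH'', oI''⟩ := A''
  rw [hW0] at oC''
  obtain rfl := mul_left_cancel₀ (hw 0) oC''
  obtain rfl : δ₁ = 0 := mul0 (hW 1) (by simpa using oA'')
  rw [hU3] at oF''
  obtain rfl := add_left_cancel oF''
  rw [mul_zero, mul_zero, zero_add, zero_add] at oI''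
  obtain rfl := oI''
  obtain rfl : δ₂ = 1 := by
    rw [hU3, hW3, mul_neg, mul_inv_cancel₀ (hκ 3)] at Q''
    simp only [mul_zero, zero_add, add_zero] at Q''
    exact add_neg_eq_zero.1 Q''
  have hW2 : W 2 = w 2 := by
    rw [hU0, mul_neg, mul_inv_cancel_left₀ (hsu 0), mul_zero, add_zero, mul_one] at T1''
    exact (neg_add_eq_zero.1 T1'').symm
  have hU2 : U 2 = u 2 := by
    rw [hW5, mul_neg, mul_inv_cancel_left₀ (hw 5), mul_zero, add_zero, mul_one] at T2''
    exact scancel (add_neg_eq_zero.1 T2'')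
  constructor <;> funext l <;> fin_cases l <;> assumption

/-- The function on faces vanishes at the faces that are bounded for one of the positions of the
lines. -/
def VanishesInside (m : Bool → Bool → Bool → Bool → D) : Prop :=
  (m true true true true = 0 ∧ m true true false true = 0 ∧ m true false false true = 0 ∧
    m false false false true = 0) ∧ m false false false false = 0 ∧ m false false true false = 0 ∧
    m false true true false = 0 ∧ m true true true false = 0

theorem IsWeyl.eq_of_combination (h : IsWeyl q u w) (H : IsWeyl q U W) (κ : Fin 6 → ℂˣ)
    (hne₁ : (κ 1 : ℂ) • u 1 - (s : ℂ) • u 0 ≠ 0) (hne₂ : (κ 4 : ℂ) • w 4 - (s : ℂ) • w 5 ≠ 0)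
    (hr : ∀ m, VanishesInside m →
      Combination s κ u w ![(false, false), (false, false), (false, false), (false, true),
        (false, true), (false, true)] m →
      Combination s κ U W ![(false, false), (false, false), (false, false), (false, true),
        (false, true), (false, true)] m) :
    U = u ∧ W = w := by
  refine h.eq_of_faceRel H κ hne₁ hne₂ fun α₀ α₁ α₂ α₃ α₄ α₅ T1 Q T2 => ?_
  have hv : VanishesInside (tot s κ u w ![(false, false), (false, false), (false, false),
      (false, true), (false, true), (false, true)] ![α₀, α₁, α₂, α₃, α₄, α₅]) := by
    -- Five of the eight labels belong to no face of the final arrangement, so the value there is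
    -- zero. The other three are its bounded faces, where `T1`, `Q`, `T2` apply.
    refine ⟨⟨?_, ?_, ?_, ?_⟩, ?_, ?_, ?_, ?_⟩
    · simp [tot]
    · simp [tot]
    · simp [tot]
    · simp [tot]
    · exact Eq.trans (by simp [tot, corner]) T1
    · exact Eq.trans (by simp [tot, corner]) Q
    · exact Eq.trans (by simp [tot, corner]) T2
    · simp [tot]
  obtain ⟨β, hβ⟩ := hr _ hv ⟨_, rfl⟩
  have hf : ∀ a b c d, _ := fun a b c d => congrFun (congrFun (congrFun (congrFun hβ a) b) c) d
  refine ⟨β 0, β 1, β 2, β 3, β 4, β 5, ?_, ?_, ?_, ?_, ?_, ?_, ?_, ?_, ?_, ?_, ?_⟩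
  · exact Eq.trans (by simp [tot, corner]) ((hf _ _ _ _).trans hv.2.1)
  · exact Eq.trans (by simp [tot, corner]) ((hf _ _ _ _).trans hv.2.2.1)
  · exact Eq.trans (by simp [tot, corner]) ((hf _ _ _ _).trans hv.2.2.2.1)
  · simpa [tot, corner] using hf true false false false
  · simpa [tot, corner] using hf false true false false
  · simpa [tot, corner] using hf true true false false
  · simpa [tot, corner] using hf true false true false
  · simpa [tot, corner] using hf false false true true
  · simpa [tot, corner] using hf true false true true
  · simpa [tot, corner] using hf false true false true
  · simpa [tot, corner] using hf false true true true

end uniqueness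

/-! ### Compatibility of the reversal with homomorphisms -/

section transport

variable {q s : ℂˣ} {n : ℕ} {D E : Type*} [DivisionRing D] [Algebra ℂ D] [DivisionRing E]
  [Algebra ℂ E] {i j k : Fin n}

theorem map_lam (f : D →ₐ[ℂ] E) (κ : Fin n → ℂˣ) (u w : Fin n → D) :
    lam1 s κ (fun l => f (u l)) (fun l => f (w l)) i j k = f (lam1 s κ u w i j k) ∧
    lam2 s κ (fun l => f (u l)) (fun l => f (w l)) i j k = f (lam2 s κ u w i j k) ∧
    lam3 s κ (fun l => f (u l)) (fun l => f (w l)) i j k = f (lam3 s κ u w i j k) := by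
  simp only [lam1, lam2, lam3, map_add, map_sub, map_smul, map_mul, map_inv₀, and_self]

theorem map_flip (f : D →ₐ[ℂ] E) (κ : Fin n → ℂˣ) (u w : Fin n → D) :
    flipU s κ i j k (fun l => f (u l)) (fun l => f (w l)) = (fun l => f (flipU s κ i j k u w l)) ∧
    flipW s κ i j k (fun l => f (u l)) (fun l => f (w l)) =
      fun l => f (flipW s κ i j k u w l) := by
  obtain ⟨h1, h2, h3⟩ := map_lam (s := s) (i := i) (j := j) (k := k) f κ u w
  constructor <;> funext l <;> simp only [flipU, flipW, h1, h2, h3] <;> split_ifs <;>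
    simp only [map_mul, map_inv₀]

theorem LamNeZero.map {κ : Fin n → ℂˣ} {u w : Fin n → D} (h : LamNeZero s κ u w i j k)
    (f : D →ₐ[ℂ] E) : LamNeZero s κ (fun l => f (u l)) (fun l => f (w l)) i j k := by
  obtain ⟨h1, h2, h3⟩ := map_lam (s := s) (i := i) (j := j) (k := k) f κ u w
  exact ⟨by rw [h1]; exact (map_ne_zero f).2 h.1, by rw [h2]; exact (map_ne_zero f).2 h.2,
    by rw [h3]; exact (map_ne_zero f).2 h.3⟩

end transport

namespace WeylFrac

variable {q s : ℂˣ} {n : ℕ} {i j k : Fin n}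

/-- The images of the `u l` under an automorphism. -/
noncomputable def imageU (f : WeylFrac q n ≃ₐ[ℂ] WeylFrac q n) (l : Fin n) : WeylFrac q n :=
  f (u q l)

/-- The images of the `w l` under an automorphism. -/
noncomputable def imageW (f : WeylFrac q n ≃ₐ[ℂ] WeylFrac q n) (l : Fin n) : WeylFrac q n :=
  f (w q l)

theorem isWeyl_image (f : WeylFrac q n ≃ₐ[ℂ] WeylFrac q n) : IsWeyl q (imageU f) (imageW f) :=
  (isWeyl q n).map (f : WeylFrac q n →ₐ[ℂ] WeylFrac q n)

theorem lamNeZero_image (hs : s ^ 2 = q) (hd : Distinct i j k) (κ : Fin n → ℂˣ)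
    (f : WeylFrac q n ≃ₐ[ℂ] WeylFrac q n) : LamNeZero s κ (imageU f) (imageW f) i j k :=
  (lamNeZero hs hd κ).map (f : WeylFrac q n →ₐ[ℂ] WeylFrac q n)

/-- Homomorphisms commute with the rational formulas for the images. So multiplying by `R` on the
right reverses one more triangle, in the current pairs, and a product read from left to right is a
sequence of reversals. -/
theorem image_mul {κ : Fin n → ℂˣ} {R : WeylFrac q n ≃ₐ[ℂ] WeylFrac q n}
    (hR : IsR q s κ i j k R) (hd : Distinct i j k) (f : WeylFrac q n ≃ₐ[ℂ] WeylFrac q n) :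
    imageU (f * R) = flipU s κ i j k (imageU f) (imageW f) ∧
      imageW (f * R) = flipW s κ i j k (imageU f) (imageW f) := by
  obtain ⟨hu, hw⟩ := (isR_iff hd κ R).1 hR
  obtain ⟨h1, h2⟩ := map_flip (s := s) (i := i) (j := j) (k := k)
    (f : WeylFrac q n →ₐ[ℂ] WeylFrac q n) κ (u q) (w q)
  refine ⟨Eq.trans (funext fun l => ?_) h1.symm, Eq.trans (funext fun l => ?_) h2.symm⟩
  · exact congrArg f (hu l)
  · exact congrArg f (hw l)

theorem image_injective {f g : WeylFrac q n ≃ₐ[ℂ] WeylFrac q n} (hu : imageU f = imageU g)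
    (hw : imageW f = imageW g) : f = g := by
  have := algHom_ext (f := (f : WeylFrac q n →ₐ[ℂ] WeylFrac q n))
    (g := (g : WeylFrac q n →ₐ[ℂ] WeylFrac q n)) (congrFun hu) (congrFun hw)
  ext x
  exact DFunLike.congr_fun this x

theorem sub_ne_zero_of_ne (a b : ℂˣ) (h : i ≠ j) :
    (a : ℂ) • (u q i : WeylFrac q n) - (b : ℂ) • u q j ≠ 0 ∧
      (a : ℂ) • (w q i : WeylFrac q n) - (b : ℂ) • w q j ≠ 0 := by
  have h₁ : ∀ l : Fin n, u q l = (isWeyl q n).monoVal (Pi.single l 1, 0) := fun l => by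
    simp [IsWeyl.monoVal, zpowProd_single]
  have h₂ : ∀ l : Fin n, w q l = (isWeyl q n).monoVal (0, Pi.single l 1) := fun l => by
    simp [IsWeyl.monoVal, zpowProd_single]
  have e₁ : ((Pi.single i 1, 0) : WeylExp n) ≠ (Pi.single j 1, 0) := fun e => by
    simpa [h] using congrFun (congrArg Prod.fst e) i
  have e₂ : ((0, Pi.single i 1) : WeylExp n) ≠ (0, Pi.single j 1) := fun e => by
    simpa [h] using congrFun (congrArg Prod.snd e) i
  constructor
  · have := three_terms_ne_zero (q := q) e₁ e₁ a.ne_zero (-(b : ℂ)) 0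
    rwa [zero_smul, add_zero, neg_smul, ← sub_eq_add_neg, ← h₁, ← h₁] at this
  · have := three_terms_ne_zero (q := q) e₂ e₂ a.ne_zero (-(b : ℂ)) 0
    rwa [zero_smul, add_zero, neg_smul, ← sub_eq_add_neg, ← h₂, ← h₂] at this

end WeylFrac

/-! ### The tetrahedron equation -/

open WeylFrac in
theorem WeylFrac.tetrahedron {q s : ℂˣ} (hs : s ^ 2 = q) (κ : Fin 6 → ℂˣ)
    {R₁₂₃ R₁₄₅ R₂₄₆ R₃₅₆ : WeylFrac q 6 ≃ₐ[ℂ] WeylFrac q 6} (h₁₂₃ : IsR q s κ 0 1 2 R₁₂₃)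
    (h₁₄₅ : IsR q s κ 0 3 4 R₁₄₅) (h₂₄₆ : IsR q s κ 1 3 5 R₂₄₆) (h₃₅₆ : IsR q s κ 2 4 5 R₃₅₆) :
    R₁₂₃ * R₁₄₅ * R₂₄₆ * R₃₅₆ = R₃₅₆ * R₂₄₆ * R₁₄₅ * R₁₂₃ := by
  have d₁₂₃ : Distinct (0 : Fin 6) 1 2 := ⟨by decide, by decide, by decide⟩
  have d₁₄₅ : Distinct (0 : Fin 6) 3 4 := ⟨by decide, by decide, by decide⟩
  have d₂₄₆ : Distinct (1 : Fin 6) 3 5 := ⟨by decide, by decide, by decide⟩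
  have d₃₅₆ : Distinct (2 : Fin 6) 4 5 := ⟨by decide, by decide, by decide⟩
  have f₁₂₃ := fun (f : WeylFrac q 6 ≃ₐ[ℂ] WeylFrac q 6) =>
    combination_flip_123 (isWeyl_image f) hs κ (lamNeZero_image hs d₁₂₃ κ f)
  have f₁₄₅ := fun (f : WeylFrac q 6 ≃ₐ[ℂ] WeylFrac q 6) =>
    combination_flip_145 (isWeyl_image f) hs κ (lamNeZero_image hs d₁₄₅ κ f)
  have f₂₄₆ := fun (f : WeylFrac q 6 ≃ₐ[ℂ] WeylFrac q 6) =>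
    combination_flip_246 (isWeyl_image f) hs κ (lamNeZero_image hs d₂₄₆ κ f)
  have f₃₅₆ := fun (f : WeylFrac q 6 ≃ₐ[ℂ] WeylFrac q 6) =>
    combination_flip_356 (isWeyl_image f) hs κ (lamNeZero_image hs d₃₅₆ κ f)
  simp only [← (image_mul h₁₂₃ d₁₂₃ _).1, ← (image_mul h₁₂₃ d₁₂₃ _).2] at f₁₂₃
  simp only [← (image_mul h₁₄₅ d₁₄₅ _).1, ← (image_mul h₁₄₅ d₁₄₅ _).2] at f₁₄₅
  simp only [← (image_mul h₂₄₆ d₂₄₆ _).1, ← (image_mul h₂₄₆ d₂₄₆ _).2] at f₂₄₆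
  simp only [← (image_mul h₃₅₆ d₃₅₆ _).1, ← (image_mul h₃₅₆ d₃₅₆ _).2] at f₃₅₆
  suffices h : _ ∧ _ from image_injective h.1 h.2
  refine (isWeyl_image (R₃₅₆ * R₂₄₆ * R₁₄₅ * R₁₂₃)).eq_of_combination (s := s)
    (isWeyl_image (R₁₂₃ * R₁₄₅ * R₂₄₆ * R₃₅₆)) κ ?_ ?_ ?_
  · rw [imageU, imageU, ← map_smul, ← map_smul, ← map_sub]
    exact (map_ne_zero _).2 (sub_ne_zero_of_ne _ _ (by decide)).1
  · rw [imageW, imageW, ← map_smul, ← map_smul, ← map_sub]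
    exact (map_ne_zero _).2 (sub_ne_zero_of_ne _ _ (by decide)).2
  · rintro m ⟨⟨m1, m2, m3, m4⟩, m5, m6, m7, m8⟩ hm
    -- The `r` steps undo the reversals of the right side, from the final arrangement back to the
    -- initial one with the original generators; the `l` steps then perform the reversals of the
    -- left side. Each step consumes the two vanishing values at its own triangle and at the
    -- reversed one.
    have r₁ := (f₁₂₃ (R₃₅₆ * R₂₄₆ * R₁₄₅) false false false false m m8 m5).2 hm
    have r₂ := (f₁₄₅ (R₃₅₆ * R₂₄₆) true true true false m m1 m6).2 r₁
    have r₃ := (f₂₄₆ R₃₅₆ true true true true m m2 m7).2 r₂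
    rw [← one_mul R₃₅₆] at r₃
    have r₄ := (f₃₅₆ 1 true true true true m m3 m8).2 r₃
    have l₁ := (f₁₂₃ 1 true true true true m m1 m4).1 r₄
    rw [one_mul] at l₁
    have l₂ := (f₁₄₅ R₁₂₃ false false false true m m2 m5).1 l₁
    have l₃ := (f₂₄₆ (R₁₂₃ * R₁₄₅) false false false false m m3 m6).1 l₂
    exact (f₃₅₆ (R₁₂₃ * R₁₄₅ * R₂₄₆) false false false false m m4 m7).1 l₃

/-- The vertices `1, …, 6` are the elements `0, …, 5` of `Fin 6`. The product of automorphisms is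
composition, `(A * B) Φ = A (B Φ)`. -/
theorem mainTheorem2 (q s : ℂˣ) (hs : s ^ 2 = q) (κ : Fin 6 → ℂˣ) :
    (∀ i j k : Fin 6, i ≠ j → i ≠ k → j ≠ k →
      ∃! R : WeylFrac q 6 ≃ₐ[ℂ] WeylFrac q 6, WeylFrac.IsR q s κ i j k R) ∧
    (∀ R₁₂₃ R₁₄₅ R₂₄₆ R₃₅₆ : WeylFrac q 6 ≃ₐ[ℂ] WeylFrac q 6,
      WeylFrac.IsR q s κ 0 1 2 R₁₂₃ → WeylFrac.IsR q s κ 0 3 4 R₁₄₅ →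
      WeylFrac.IsR q s κ 1 3 5 R₂₄₆ → WeylFrac.IsR q s κ 2 4 5 R₃₅₆ →
      R₁₂₃ * R₁₄₅ * R₂₄₆ * R₃₅₆ = R₃₅₆ * R₂₄₆ * R₁₄₅ * R₁₂₃) :=
  ⟨fun _ _ _ hij hik hjk => WeylFrac.existsUnique_isR hs ⟨hij, hik, hjk⟩ κ,
    fun _ _ _ _ => WeylFrac.tetrahedron hs κ⟩
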